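/- Let $0\le r\le\infty$. Let $\overline M$ be a Hausdorff, second countable manifold of class $C^{r+1}$ and dimension $n+1\ge 1$, possibly with boundary, and let $(\overline M,g)$ be a spacetime-with-timelike-boundary: $g$ is a $C^r$ Lorentzian metric of signature $(-,+,\dots,+)$ on $\overline M$ whose pull-back to $\partial\overline M$ is Lorentzian, together with a time orientation (a continuous choice of one of the two causal cones, the future cone, at each point). A future-directed causal (timelike) curve is a locally Lipschitz curve on an interval whose velocity is almost everywhere future causal (and, respectively, timelike); it is inextensible if it has neither a future nor a past endpoint in $\overline M$. A generalized time function is a function $\overline M\to\mathbb R$ that is strictly increasing along all future-directed causal curves, a time function is a continuous one, and a temporal function is a generalized time function $\tau$ of class $C^{r+1}$ whose $g$-gradient $\nabla\tau$ is everywhere timelike. The spacetime is stably causal if it admits a time function. A temporal function $\tau$ is Cauchy temporal if it is onto $\mathbb R$ and every level set $\tau^{-1}(c)$, $c\in\mathbb R$, is a Cauchy hypersurface, i.e. is met exactly once by every inextensible timelike curve. For a $C^r$ Riemannian metric $h$ on $\overline M$, a $C^1$ function $\tau$ is $h$-steep if $d\tau(v)\ge\|v\|_h$ for all future causal vectors $v$;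 and $h$ is complete if $\overline M$ is complete for the distance of $h$ (the infimum of lengths of curves in $\overline M$). For a temporal function $\tau$ write $g=-\Lambda\,d\tau^2+\sigma_\tau$ along the orthogonal splitting $T\overline M=\mathrm{Span}(\nabla\tau)\oplus(\nabla\tau)^\perp$, where $\Lambda=-1/g(\nabla\tau,\nabla\tau)>0$ and $\sigma_\tau$ is the restriction of $g$ to $(\nabla\tau)^\perp$ extended by $0$ to $\mathrm{Span}(\nabla\tau)$; put $\bar\sigma_\tau=\sigma_\tau/\Lambda$. The Wick-rotated metric is the Riemannian metric $g_W^\tau=d\tau^2+\bar\sigma_\tau$. **Theorem.** Let $(\overline M,g)$ be a stably causal spacetime-with-timelike-boundary and let $\tau:\overline M\to\mathbb R$ be an onto temporal function. The following are equivalent: (i) $\tau$ is $h$-steep for some complete Riemannian metric $h$ on $\overline M$; (ii) the Wick-rotated metric $g_W^\tau$ is complete. In this case, (a) $\tau$ is $h$-steep with respect to $h=g_W^\tau/2$, and (b) $\tau$ is a Cauchy temporal function. -/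

import Mathlib

open Set Filter Topology MeasureTheory Bundle Manifold
open scoped ContDiff ENNReal

noncomputable section

namespace Wick

/-! ### Linear algebra of Lorentzian scalar products -/

section LinearAlgebra

variable {V : Type*} [AddCommGroup V] [Module ℝ V] [TopologicalSpace V]

/-- The restriction of the bilinear form `b` to the subspace `W` has signature `(-, +, …, +)`:
there is a vector `e` of `W` with `b e e < 0` on whose `b`-orthogonal complement in `W` the form
is positive definite. -/
def IsLorentzOn (b : V →L[ℝ] V →L[ℝ] ℝ) (W : Submodule ℝ V) : Prop :=
  ∃ e ∈ W, b e e < 0 ∧ ∀ w ∈ W, b e w = 0 → w ≠ 0 → 0 < b w w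

/-- Lorentzian forms are nondegenerate. -/
theorem IsLorentzOn.eq_zero {b : V →L[ℝ] V →L[ℝ] ℝ} (hs : ∀ v w, b v w = b w v)
    (hb : IsLorentzOn b ⊤) {w : V} (hw : ∀ u, b w u = 0) : w = 0 := by
  obtain ⟨e, -, -, hpos⟩ := hb
  by_contra hne
  have h1 := hpos w trivial (by rw [hs]; exact hw e) hne
  rw [hw w] at h1
  exact lt_irrefl _ h1

/-- A nonzero vector orthogonal to a timelike vector is spacelike. -/
theorem IsLorentzOn.pos_of_orthogonal {b : V →L[ℝ] V →L[ℝ] ℝ} (hs : ∀ v w, b v w = b w v)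
    (hb : IsLorentzOn b ⊤) {N w : V} (hN : b N N < 0) (hNw : b N w = 0) (hw : w ≠ 0) :
    0 < b w w := by
  obtain ⟨e, -, he, hpos⟩ := hb
  have hnn : ∀ u, b e u = 0 → 0 ≤ b u u := by
    intro u hu
    by_cases h0 : u = 0
    · simp [h0]
    · exact (hpos u trivial hu h0).le
  set α := b e N / b e e with hα
  set β := b e w / b e e with hβ
  set p := N - α • e with hp
  set q := w - β • e with hq
  have hep : b e p = 0 := by simp [hp, hα]; field_simp [he.ne]; ring
  have heq : b e q = 0 := by simp [hq, hβ]; field_simp [he.ne]; ring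
  have hpe : b p e = 0 := by rw [hs]; exact hep
  have hqe : b q e = 0 := by rw [hs]; exact heq
  have hN' : N = α • e + p := by simp [hp]
  have hw' : w = β • e + q := by simp [hq]
  have h1 : b N N = α ^ 2 * b e e + b p p := by
    rw [hN']; simp [hep, hpe]; ring
  have h2 : b N w = α * β * b e e + b p q := by
    rw [hN', hw']; simp [heq, hpe]; ring
  have h3 : b w w = β ^ 2 * b e e + b q q := by
    rw [hw']; simp [heq, hqe]; ring
  have hq0 : q ≠ 0 := by
    intro h0
    have hβ0 : α * β * b e e = 0 := by rw [h2, h0] at hNw; simpa using hNw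
    have hα0 : α ≠ 0 := by
      rintro h
      have := hnn p hep
      rw [h1, h] at hN
      nlinarith
    have : β = 0 := by
      rcases mul_eq_zero.1 hβ0 with h | h
      · exact (mul_eq_zero.1 h).resolve_left hα0
      · exact absurd h he.ne
    exact hw (by rw [hw', h0, this]; simp)
  have hqq := hpos q trivial heq hq0
  have hpp := hnn p hep
  have hcs : b p q ^ 2 ≤ b p p * b q q := by
    have h4 := hnn (b q q • p - b p q • q) (by simp [hep, heq])
    have h5 : b (b q q • p - b p q • q) (b q q • p - b p q • q)
        = b q q * (b p p * b q q - b p q ^ 2) := by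
      simp [hs q p]; ring
    rw [h5] at h4
    have := nonneg_of_mul_nonneg_right h4 hqq
    linarith
  rw [h3]
  rw [h2] at hNw
  rw [h1] at hN
  have h6 : b p q = - (α * β * b e e) := by linarith
  rw [h6] at hcs
  by_contra hcon
  push Not at hcon
  have hα2 : 0 < α ^ 2 := by
    by_contra h
    have : α ^ 2 = 0 := le_antisymm (not_lt.1 h) (sq_nonneg _)
    rw [this] at hN
    linarith
  have h7 : b p p * b q q < (-(α ^ 2 * b e e)) * b q q := by
    apply mul_lt_mul_of_pos_right _ hqq; linarith
  have h8 : (-(α ^ 2 * b e e)) * b q q ≤ (-(α ^ 2 * b e e)) * (-(β ^ 2 * b e e)) := by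
    apply mul_le_mul_of_nonneg_left (by linarith)
    nlinarith
  nlinarith

/-- In finite dimension, a nondegenerate bilinear form represents every linear form. -/
theorem exists_repr [FiniteDimensional ℝ V] {b : V →L[ℝ] V →L[ℝ] ℝ}
    (hb : ∀ w, (∀ u, b w u = 0) → w = 0) (φ : V →L[ℝ] ℝ) : ∃ N, b N = φ := by
  let B : V →ₗ[ℝ] Module.Dual ℝ V :=
    { toFun := fun v => (b v).toLinearMap
      map_add' := fun v w => by ext; simp
      map_smul' := fun c v => by ext; simp }
  have hinj : Function.Injective B := by
    rw [injective_iff_map_eq_zero]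
    intro w hw
    exact hb w fun u => LinearMap.congr_fun hw u
  obtain ⟨N, hN⟩ := (LinearMap.injective_iff_surjective_of_finrank_eq_finrank
    (Subspace.dual_finrank_eq (K := ℝ) (V := V)).symm).1 hinj φ.toLinearMap
  exact ⟨N, by ext v; exact LinearMap.congr_fun hN v⟩

end LinearAlgebra

/-- The unit ball of a positive definite form on a finite-dimensional space is bounded. -/
theorem isVonNBounded_of_pos {E : Type*} [NormedAddCommGroup E] [NormedSpace ℝ E]
    [FiniteDimensional ℝ E] (b : E →L[ℝ] E →L[ℝ] ℝ) (hb : ∀ v, v ≠ 0 → 0 < b v v) :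
    Bornology.IsVonNBounded ℝ {v : E | b v v < 1} := by
  rw [NormedSpace.isVonNBounded_iff]
  have hc : Continuous fun v : E => b v v := by fun_prop
  obtain ⟨c, hc0, hcb⟩ : ∃ c > 0, ∀ u ∈ Metric.sphere (0 : E) 1, c ≤ b u u := by
    rcases (Metric.sphere (0 : E) 1).eq_empty_or_nonempty with h | h
    · exact ⟨1, one_pos, by simp [h]⟩
    · obtain ⟨u, hu, hmin⟩ := (isCompact_sphere (0 : E) 1).exists_isMinOn h hc.continuousOn
      refine ⟨b u u, hb u ?_, fun w hw => hmin hw⟩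
      rintro rfl
      simp at hu
  refine (Metric.isBounded_iff_subset_closedBall 0).2 ⟨1 + c⁻¹, fun v hv => ?_⟩
  rw [mem_closedBall_zero_iff]
  rcases eq_or_ne v 0 with rfl | hv0
  · simp; positivity
  have hn : 0 < ‖v‖ := norm_pos_iff.2 hv0
  have h1 := hcb (‖v‖⁻¹ • v) (by simp [norm_smul, hn.ne'])
  have h2 : b (‖v‖⁻¹ • v) (‖v‖⁻¹ • v) = b v v / ‖v‖ ^ 2 := by
    simp; field_simp
  rw [h2, le_div_iff₀ (by positivity)] at h1
  have h3 : c * ‖v‖ ^ 2 < 1 := lt_of_le_of_lt h1 hv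
  by_contra hcon
  push Not at hcon
  have h4 : c⁻¹ < ‖v‖ := by linarith
  have h5 : 1 < c * ‖v‖ := by
    have := mul_lt_mul_of_pos_left h4 hc0
    rwa [mul_inv_cancel₀ hc0.ne'] at this
  have h6 : 1 ≤ ‖v‖ := by have : 0 < c⁻¹ := inv_pos.2 hc0; linarith
  nlinarith


set_option synthInstance.maxHeartbeats 400000 in
/-- Regularity of the coordinate expression `-D(A⁻¹D) • A + 2 D ⊗ D`. -/
theorem contMDiffAt_coord {E H M F : Type*} [NormedAddCommGroup F] [NormedSpace ℝ F]
    [TopologicalSpace H] {I : ModelWithCorners ℝ F H} [TopologicalSpace M] [ChartedSpace H M]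
    [NormedAddCommGroup E] [NormedSpace ℝ E] [FiniteDimensional ℝ E] {r : ℕ∞ω}
    {A : M → E →L[ℝ] E →L[ℝ] ℝ} {D : M → E →L[ℝ] ℝ} {x₀ : M}
    (hA : ContMDiffAt I 𝓘(ℝ, E →L[ℝ] E →L[ℝ] ℝ) r A x₀)
    (hD : ContMDiffAt I 𝓘(ℝ, E →L[ℝ] ℝ) r D x₀) (hinv : (A x₀).IsInvertible) :
    ContMDiffAt I 𝓘(ℝ, E →L[ℝ] E →L[ℝ] ℝ) r
      (fun x => (-(D x ((A x).inverse (D x)))) • A x + (2 : ℝ) • (D x).smulRight (D x)) x₀ := by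
  have : CompleteSpace E := FiniteDimensional.complete ℝ E
  obtain ⟨F₀, hF₀⟩ := hinv
  have hI : ContMDiffAt I 𝓘(ℝ, (E →L[ℝ] ℝ) →L[ℝ] E) r (fun x => (A x).inverse) x₀ := by
    have h1 : ContDiffAt ℝ r ContinuousLinearMap.inverse (A x₀) := by
      rw [← hF₀]; exact contDiffAt_map_inverse F₀
    exact h1.contMDiffAt.comp x₀ hA
  have hl : ContMDiffAt I 𝓘(ℝ, ℝ) r (fun x => - D x ((A x).inverse (D x))) x₀ :=
    (hD.clm_apply (hI.clm_apply hD)).neg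
  have hDD : ContMDiffAt I 𝓘(ℝ, E →L[ℝ] E →L[ℝ] ℝ) r
      (fun x => ContinuousLinearMap.smulRightL ℝ E (E →L[ℝ] ℝ) (D x) (D x)) x₀ :=
    (contMDiffAt_const.clm_apply hD).clm_apply hD
  have h2 : ContMDiffAt I 𝓘(ℝ, ℝ) r (fun _ : M => (2 : ℝ)) x₀ := contMDiffAt_const
  exact (hl.smul hA).add (h2.smul hDD)

/-- In finite dimension, a nondegenerate bilinear form is invertible. -/
theorem isInvertible_of_nondegenerate {E : Type*} [NormedAddCommGroup E] [NormedSpace ℝ E]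
    [FiniteDimensional ℝ E] {b : E →L[ℝ] E →L[ℝ] ℝ} (hb : ∀ w, (∀ u, b w u = 0) → w = 0) :
    b.IsInvertible := by
  have : CompleteSpace E := FiniteDimensional.complete ℝ E
  refine ⟨ContinuousLinearEquiv.ofBijective b ?_ ?_, by ext; rfl⟩
  · exact LinearMap.ker_eq_bot'.2 fun w hw => hb w fun u => by
      have : b w = 0 := hw
      simp [this]
  · exact LinearMap.range_eq_top.2 fun φ => exists_repr hb φ

/-! ### Spacetimes with timelike boundary -/

section Spacetime

/-- The tangent space `T_x(∂M)` of the boundary at a boundary point `x`: the vectors of `T_x M`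
annihilated by the differential of the coordinate `x⁰ ≥ 0` of a half-space chart at `x`, which is a
defining function of the boundary near `x`. -/
def boundaryTangentSpace {n : ℕ} {M : Type*} [TopologicalSpace M]
    [ChartedSpace (EuclideanHalfSpace (n + 1)) M] (x : M) :
    Submodule ℝ (TangentSpace (𝓡∂ (n + 1)) x) :=
  LinearMap.ker (mfderiv (𝓡∂ (n + 1)) 𝓘(ℝ, ℝ)
    (fun y : M => (extChartAt (𝓡∂ (n + 1)) x y) 0) x).toLinearMap

/-- A Lorentzian metric of class `C^r` on a manifold (possibly with boundary) of dimension
`n + 1`. -/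
structure LorentzianMetric (n : ℕ) (r : ℕ∞) (M : Type*) [TopologicalSpace M]
    [ChartedSpace (EuclideanHalfSpace (n + 1)) M] [IsManifold (𝓡∂ (n + 1)) 1 M] where
  /-- The scalar product on the tangent spaces. -/
  val (x : M) : TangentSpace (𝓡∂ (n + 1)) x →L[ℝ] TangentSpace (𝓡∂ (n + 1)) x →L[ℝ] ℝ
  symm (x : M) (v w : TangentSpace (𝓡∂ (n + 1)) x) : val x v w = val x w v
  lorentz (x : M) : IsLorentzOn (val x) ⊤
  contMDiff : ContMDiff (𝓡∂ (n + 1)) ((𝓡∂ (n + 1)).prod 𝓘(ℝ, EuclideanSpace ℝ (Fin (n + 1)) →L[ℝ]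
      EuclideanSpace ℝ (Fin (n + 1)) →L[ℝ] ℝ)) r
    (fun x => TotalSpace.mk' (EuclideanSpace ℝ (Fin (n + 1)) →L[ℝ]
      EuclideanSpace ℝ (Fin (n + 1)) →L[ℝ] ℝ) x (val x))

/-- A spacetime-with-timelike-boundary: a Lorentzian manifold whose metric restricts to a Lorentzian
metric on the boundary, with a time orientation, i.e. a continuous choice `future x` of one of the
two causal cones at each point `x`. -/
structure Spacetime (n : ℕ) (r : ℕ∞) (M : Type*) [TopologicalSpace M]
    [ChartedSpace (EuclideanHalfSpace (n + 1)) M] [IsManifold (𝓡∂ (n + 1)) 1 M]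
    extends LorentzianMetric n r M where
  lorentz_boundary (x : M) (hx : x ∈ (𝓡∂ (n + 1)).boundary M) :
    IsLorentzOn (val x) (boundaryTangentSpace x)
  /-- The set of future causal vectors at each point. -/
  future (x : M) : Set (TangentSpace (𝓡∂ (n + 1)) x)
  time_oriented (x : M) : ∃ U ∈ 𝓝 x, ∃ T : ∀ y : M, TangentSpace (𝓡∂ (n + 1)) y,
    ContinuousOn (fun y => (⟨y, T y⟩ : TangentBundle (𝓡∂ (n + 1)) M)) U ∧
    ∀ y ∈ U, val y (T y) (T y) < 0 ∧ future y = {v | v ≠ 0 ∧ val y v v ≤ 0 ∧ val y (T y) v < 0}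

namespace Spacetime

variable {n : ℕ} {r : ℕ∞} {M : Type*} [TopologicalSpace M]
  [ChartedSpace (EuclideanHalfSpace (n + 1)) M] [IsManifold (𝓡∂ (n + 1)) 1 M]
  (S : Spacetime n r M)

/-- A curve `γ` (defined on the interval `J`) is locally Lipschitz if it is so in charts. -/
def IsLocallyLipschitzCurve (γ : ℝ → M) (J : Set ℝ) : Prop :=
  ContinuousOn γ J ∧ ∀ t ∈ J, ∃ K, ∃ W ∈ 𝓝[J] t,
    LipschitzOnWith K (fun s => extChartAt (𝓡∂ (n + 1)) (γ t) (γ s)) W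

/-- A future-directed causal curve on the interval `J`: a locally Lipschitz curve whose velocity is
future causal almost everywhere. -/
def IsFutureCausalCurve (γ : ℝ → M) (J : Set ℝ) : Prop :=
  J.OrdConnected ∧ J.Nontrivial ∧ IsLocallyLipschitzCurve (n := n) γ J ∧
  ∀ᵐ t ∂(volume.restrict J), MDifferentiableAt 𝓘(ℝ, ℝ) (𝓡∂ (n + 1)) γ t ∧
    mfderiv 𝓘(ℝ, ℝ) (𝓡∂ (n + 1)) γ t (1 : ℝ) ∈ S.future (γ t)

/-- A future-directed timelike curve on the interval `J`: a future-directed causal curve whose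
velocity is timelike almost everywhere. -/
def IsFutureTimelikeCurve (γ : ℝ → M) (J : Set ℝ) : Prop :=
  S.IsFutureCausalCurve γ J ∧ ∀ᵐ t ∂(volume.restrict J),
    S.val (γ t) (mfderiv 𝓘(ℝ, ℝ) (𝓡∂ (n + 1)) γ t (1 : ℝ))
      (mfderiv 𝓘(ℝ, ℝ) (𝓡∂ (n + 1)) γ t (1 : ℝ)) < 0

/-- The curve `γ` on the interval `J` has neither a future nor a past endpoint. -/
def IsInextensible (γ : ℝ → M) (J : Set ℝ) : Prop :=
  (¬ ∃ p, Tendsto (fun t : J => γ t) atTop (𝓝 p)) ∧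
  (¬ ∃ p, Tendsto (fun t : J => γ t) atBot (𝓝 p))

/-- A generalized time function: strictly increasing along all future-directed causal curves. -/
def IsGeneralizedTimeFunction (τ : M → ℝ) : Prop :=
  ∀ (γ : ℝ → M) (J : Set ℝ), S.IsFutureCausalCurve γ J → StrictMonoOn (τ ∘ γ) J

/-- A time function is a continuous generalized time function. -/
def IsTimeFunction (τ : M → ℝ) : Prop :=
  Continuous τ ∧ S.IsGeneralizedTimeFunction τ

/-- A spacetime is stably causal if it admits a time function. -/
def IsStablyCausal : Prop := ∃ τ : M → ℝ, S.IsTimeFunction τ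

/-- The differential of a real function. -/
def diff (τ : M → ℝ) (x : M) : TangentSpace (𝓡∂ (n + 1)) x →L[ℝ] ℝ :=
  mfderiv (𝓡∂ (n + 1)) 𝓘(ℝ, ℝ) τ x

theorem exists_grad (x : M) (φ : TangentSpace (𝓡∂ (n + 1)) x →L[ℝ] ℝ) :
    ∃ N, S.val x N = φ := by
  have : FiniteDimensional ℝ (TangentSpace (𝓡∂ (n + 1)) x) :=
    inferInstanceAs (FiniteDimensional ℝ (EuclideanSpace ℝ (Fin (n + 1))))
  exact exists_repr (fun _ => (S.lorentz x).eq_zero (S.symm x)) φ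

/-- The `g`-gradient of `τ`: the vector field `∇τ` with `g(∇τ, v) = dτ(v)` for all `v`. -/
def grad (τ : M → ℝ) (x : M) : TangentSpace (𝓡∂ (n + 1)) x :=
  (S.exists_grad x (diff τ x)).choose

theorem val_grad (τ : M → ℝ) (x : M) : S.val x (S.grad τ x) = diff τ x :=
  (S.exists_grad x (diff τ x)).choose_spec

/-- A temporal function: a smooth (generalized) time function with timelike gradient. -/
def IsTemporal (τ : M → ℝ) : Prop :=
  S.IsGeneralizedTimeFunction τ ∧
  ContMDiff (𝓡∂ (n + 1)) 𝓘(ℝ, ℝ) ((r : ℕ∞ω) + 1) τ ∧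
  ∀ x, S.val x (S.grad τ x) (S.grad τ x) < 0

/-- A Cauchy hypersurface: a subset crossed exactly once by every inextensible timelike curve.
(A past-directed curve, reversed, is a future-directed one, so that future-directed curves suffice.)
-/
def IsCauchyHypersurface (A : Set M) : Prop :=
  ∀ (γ : ℝ → M) (J : Set ℝ), S.IsFutureTimelikeCurve γ J → IsInextensible γ J →
    ∃! t, t ∈ J ∧ γ t ∈ A

/-- A Cauchy temporal function: a temporal function onto `ℝ` all of whose slices are Cauchy
hypersurfaces. -/
def IsCauchyTemporal (τ : M → ℝ) : Prop :=
  S.IsTemporal τ ∧ Function.Surjective τ ∧ ∀ c : ℝ, S.IsCauchyHypersurface (τ ⁻¹' {c})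

/-- Riemannian metrics of class `C^r` on `M`. -/
abbrev RiemMetric (n : ℕ) (r : ℕ∞) (M : Type*) [TopologicalSpace M]
    [ChartedSpace (EuclideanHalfSpace (n + 1)) M] [IsManifold (𝓡∂ (n + 1)) 1 M] :=
  ContMDiffRiemannianMetric (𝓡∂ (n + 1)) r (EuclideanSpace ℝ (Fin (n + 1)))
    (fun x : M => TangentSpace (𝓡∂ (n + 1)) x)

/-- The Riemannian distance: the infimum of the lengths of the `C^1` paths between two points. -/
def riemDist (h : RiemMetric n r M) (x y : M) : ℝ≥0∞ :=
  letI : RiemannianBundle (fun x : M => TangentSpace (𝓡∂ (n + 1)) x) := ⟨h.toRiemannianMetric⟩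
  riemannianEDist (𝓡∂ (n + 1)) x y

/-- A Riemannian metric is complete if every Cauchy sequence for its distance converges. -/
def IsComplete (h : RiemMetric n r M) : Prop :=
  ∀ u : ℕ → M, (∀ ε > 0, ∃ N, ∀ i ≥ N, ∀ j ≥ N, riemDist h (u i) (u j) < ε) →
    ∃ p, Tendsto u atTop (𝓝 p)

/-- `τ` is `h`-steep: it is `C^1` and `dτ(v) ≥ ‖v‖_h` for all future causal vectors `v`. -/
def IsSteep (h : RiemMetric n r M) (τ : M → ℝ) : Prop :=
  ContMDiff (𝓡∂ (n + 1)) 𝓘(ℝ, ℝ) 1 τ ∧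
  ∀ x, ∀ v ∈ S.future x, √(h.inner x v v) ≤ diff τ x v

/-- The lapse `Λ = |∇τ|⁻² = -1 / g(∇τ, ∇τ)`. -/
def lapse (τ : M → ℝ) (x : M) : ℝ := -(S.val x (S.grad τ x) (S.grad τ x))⁻¹

/-- The orthogonal projection of `T_x M = span ∇τ ⊕ (∇τ)^⊥` onto `(∇τ)^⊥`. -/
def perp (τ : M → ℝ) (x : M) :
    TangentSpace (𝓡∂ (n + 1)) x →L[ℝ] TangentSpace (𝓡∂ (n + 1)) x :=
  ContinuousLinearMap.id ℝ _ -
    (S.val x (S.grad τ x) (S.grad τ x))⁻¹ • (S.val x (S.grad τ x)).smulRight (S.grad τ x)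

/-- The tensor `σ_τ`, the restriction of `g` to `(∇τ)^⊥`, extended by zero on `∇τ`. -/
def sigma (τ : M → ℝ) (x : M) :
    TangentSpace (𝓡∂ (n + 1)) x →L[ℝ] TangentSpace (𝓡∂ (n + 1)) x →L[ℝ] ℝ :=
  (ContinuousLinearMap.precomp ℝ (S.perp τ x)).comp ((S.val x).comp (S.perp τ x))

/-- The Wick-rotated form `dτ² + σ̄_τ`, where `σ̄_τ = Λ⁻¹ σ_τ`. -/
def wickForm (τ : M → ℝ) (x : M) :
    TangentSpace (𝓡∂ (n + 1)) x →L[ℝ] TangentSpace (𝓡∂ (n + 1)) x →L[ℝ] ℝ :=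
  (diff τ x).smulRight (diff τ x) + (S.lapse τ x)⁻¹ • S.sigma τ x

theorem wickForm_apply {τ : M → ℝ} (x : M) (hx : S.val x (S.grad τ x) (S.grad τ x) ≠ 0)
    (v w : TangentSpace (𝓡∂ (n + 1)) x) :
    S.wickForm τ x v w = - diff τ x (S.grad τ x) * S.val x v w + 2 * (diff τ x v * diff τ x w) := by
  have hv : S.val x v (S.grad τ x) = S.val x (S.grad τ x) v := S.symm x _ _
  simp only [val_grad] at hv hx
  change diff τ x v * diff τ x w +
    (S.lapse τ x)⁻¹ * S.val x (S.perp τ x v) (S.perp τ x w) = _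
  simp [lapse, perp, val_grad, hv]
  field_simp
  ring

theorem wickForm_pos {τ : M → ℝ} (hτ : S.IsTemporal τ) (x : M)
    (v : TangentSpace (𝓡∂ (n + 1)) x) (hv : v ≠ 0) : 0 < S.wickForm τ x v v := by
  have hN := hτ.2.2 x
  by_cases h0 : diff τ x v = 0
  · have := (S.lorentz x).pos_of_orthogonal (S.symm x) hN (by rw [val_grad]; exact h0) hv
    rw [S.wickForm_apply x hN.ne, h0]
    rw [val_grad] at hN
    nlinarith
  · have h1 : S.val x (S.grad τ x) (S.perp τ x v) = 0 := by
      have hN' := hN.ne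
      simp only [val_grad] at hN' ⊢
      simp [perp, val_grad]
      field_simp
      ring
    have h2 : 0 ≤ S.sigma τ x v v := by
      change 0 ≤ S.val x (S.perp τ x v) (S.perp τ x v)
      by_cases hp : S.perp τ x v = 0
      · simp [hp]
      · exact ((S.lorentz x).pos_of_orthogonal (S.symm x) hN h1 hp).le
    have h3 : 0 ≤ (S.lapse τ x)⁻¹ := by
      simp only [lapse, inv_neg, inv_inv]; linarith
    have h4 : S.wickForm τ x v v = diff τ x v * diff τ x v + (S.lapse τ x)⁻¹ * S.sigma τ x v v := by
      simp [wickForm]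
    rw [h4]
    have := mul_self_pos.2 h0
    positivity

theorem contMDiffAt_diff [IsManifold (𝓡∂ (n + 1)) ((r : ℕ∞ω) + 1) M] {τ : M → ℝ}
    (hτ : ContMDiff (𝓡∂ (n + 1)) 𝓘(ℝ, ℝ) ((r : ℕ∞ω) + 1) τ) (x₀ : M) :
    ContMDiffAt (𝓡∂ (n + 1)) 𝓘(ℝ, EuclideanSpace ℝ (Fin (n + 1)) →L[ℝ] ℝ) r
      (fun x => (diff τ x).comp ((trivializationAt (EuclideanSpace ℝ (Fin (n + 1)))
        (fun x : M => TangentSpace (𝓡∂ (n + 1)) x) x₀).symmL ℝ x)) x₀ := by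
  have h := (hτ x₀).mfderiv_const (m := (r : ℕ∞ω)) le_rfl
  refine h.congr_of_eventuallyEq (Eventually.of_forall fun x => ?_)
  ext v
  simp [inTangentCoordinates, ContinuousLinearMap.inCoordinates, diff]
  rfl

theorem contMDiff_wickForm [IsManifold (𝓡∂ (n + 1)) ((r : ℕ∞ω) + 1) M] {τ : M → ℝ}
    (hτ : S.IsTemporal τ) :
    ContMDiff (𝓡∂ (n + 1)) ((𝓡∂ (n + 1)).prod 𝓘(ℝ, EuclideanSpace ℝ (Fin (n + 1)) →L[ℝ]
        EuclideanSpace ℝ (Fin (n + 1)) →L[ℝ] ℝ)) r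
      (fun x => TotalSpace.mk' (EuclideanSpace ℝ (Fin (n + 1)) →L[ℝ]
        EuclideanSpace ℝ (Fin (n + 1)) →L[ℝ] ℝ) x (S.wickForm τ x)) := by
  intro x₀
  have hg := S.contMDiff x₀
  rw [contMDiffAt_hom_bundle] at hg ⊢
  refine ⟨contMDiffAt_id, ?_⟩
  have hA := hg.2
  have hD := contMDiffAt_diff hτ.2.1 x₀
  simp only at hA ⊢
  set E := EuclideanSpace ℝ (Fin (n + 1)) with hE
  set e := trivializationAt E (fun x : M => TangentSpace (𝓡∂ (n + 1)) x) x₀ with he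
  set A : M → E →L[ℝ] E →L[ℝ] ℝ := fun x => ContinuousLinearMap.inCoordinates E
    (fun x : M => TangentSpace (𝓡∂ (n + 1)) x) (E →L[ℝ] ℝ)
    (fun x : M => TangentSpace (𝓡∂ (n + 1)) x →L[ℝ] ℝ) x₀ x x₀ x (S.val x) with hAdef
  set D : M → E →L[ℝ] ℝ := fun x => (diff τ x).comp (e.symmL ℝ x) with hDdef
  have hbase : ∀ᶠ x in 𝓝 x₀, x ∈ e.baseSet :=
    e.open_baseSet.mem_nhds (FiberBundle.mem_baseSet_trivializationAt' x₀)
  have hform : ∀ (b : ∀ x : M, TangentSpace (𝓡∂ (n + 1)) x →L[ℝ]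
      TangentSpace (𝓡∂ (n + 1)) x →L[ℝ] ℝ), ∀ x ∈ e.baseSet, ∀ v w : E,
      ContinuousLinearMap.inCoordinates E
        (fun x : M => TangentSpace (𝓡∂ (n + 1)) x) (E →L[ℝ] ℝ)
        (fun x : M => TangentSpace (𝓡∂ (n + 1)) x →L[ℝ] ℝ) x₀ x x₀ x (b x) v w
        = b x (e.symmL ℝ x v) (e.symmL ℝ x w) := by
    intro b x hx v w
    have := inCoordinates_apply_eq₂ (F₁ := E) (F₂ := E) (F₃ := ℝ)
      (E₁ := fun x : M => TangentSpace (𝓡∂ (n + 1)) x)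
      (E₂ := fun x : M => TangentSpace (𝓡∂ (n + 1)) x) (E₃ := fun _ : M => ℝ)
      (𝕜 := ℝ) (x₀ := x₀) (x := x) (ϕ := b x) (v := v) (w := w) hx hx (by simp)
    refine this.trans ?_
    rw [e.symmL_apply (R := ℝ) hx v, e.symmL_apply (R := ℝ) hx w]
    simp
    rfl
  have hnd : ∀ x ∈ e.baseSet, ∀ w, (∀ u, A x w u = 0) → w = 0 := by
    intro x hx w hw
    have h1 : e.symmL ℝ x w = 0 := by
      refine (S.lorentz x).eq_zero (S.symm x) fun u => ?_
      have h2 := hw (e.continuousLinearMapAt ℝ x u)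
      rw [hAdef, hform S.val x hx, e.symmL_continuousLinearMapAt (R := ℝ) hx] at h2
      exact h2
    rw [← e.continuousLinearMapAt_symmL (R := ℝ) hx w, h1, map_zero]
  have hinv : ∀ x ∈ e.baseSet, (A x).IsInvertible := fun x hx =>
    isInvertible_of_nondegenerate (hnd x hx)
  have hx₀ : x₀ ∈ e.baseSet := FiberBundle.mem_baseSet_trivializationAt' x₀
  refine (contMDiffAt_coord hA hD (hinv x₀ hx₀)).congr_of_eventuallyEq ?_
  filter_upwards [hbase] with x hx
  have hN : (A x).inverse (D x) = e.continuousLinearMapAt ℝ x (S.grad τ x) := by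
    rw [(hinv x hx).inverse_apply_eq]
    ext w
    rw [hAdef, hform S.val x hx, e.symmL_continuousLinearMapAt (R := ℝ) hx, val_grad]
    rfl
  have hDN : D x ((A x).inverse (D x)) = diff τ x (S.grad τ x) := by
    rw [hN, hDdef]
    change diff τ x (e.symmL ℝ x (e.continuousLinearMapAt ℝ x (S.grad τ x))) = _
    rw [e.symmL_continuousLinearMapAt (R := ℝ) hx]
  refine ContinuousLinearMap.ext fun v => ContinuousLinearMap.ext fun w => ?_
  refine (hform (S.wickForm τ) x hx v w).trans ?_
  rw [S.wickForm_apply x (hτ.2.2 x).ne, hDN]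
  change _ = -(diff τ x (S.grad τ x)) * A x v w + 2 * (D x v * D x w)
  rw [hAdef, hform S.val x hx]
  rfl

/-- The Wick-rotated Riemannian metric `g_W^τ = dτ² + σ̄_τ` of a temporal function `τ`. -/
def wick [IsManifold (𝓡∂ (n + 1)) ((r : ℕ∞ω) + 1) M] (τ : M → ℝ) (hτ : S.IsTemporal τ) :
    RiemMetric n r M where
  inner := S.wickForm τ
  symm x v w := by
    rw [S.wickForm_apply x (hτ.2.2 x).ne, S.wickForm_apply x (hτ.2.2 x).ne, S.symm x v w]; ring
  pos := S.wickForm_pos hτ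
  isVonNBounded x := isVonNBounded_of_pos (E := EuclideanSpace ℝ (Fin (n + 1)))
    (S.wickForm τ x) (S.wickForm_pos hτ x)
  contMDiff := S.contMDiff_wickForm hτ

set_option synthInstance.maxHeartbeats 400000 in
/-- The Riemannian metric `h / 2`. -/
def half (h : RiemMetric n r M) :
    RiemMetric n r M where
  inner x := (1 / 2 : ℝ) • h.inner x
  symm x v w := congrArg ((1 / 2 : ℝ) * ·) (h.symm x v w)
  pos x v hv := mul_pos one_half_pos (h.pos x v hv)
  isVonNBounded x := isVonNBounded_of_pos (E := EuclideanSpace ℝ (Fin (n + 1)))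
    ((1 / 2 : ℝ) • h.inner x) (fun v hv => mul_pos one_half_pos (h.pos x v hv))
  contMDiff := h.contMDiff.const_smul_section

end Spacetime

end Spacetime

end Wick

/-!
Let `τ` be a temporal function and `h` a Riemannian metric.

The comparison of `h` with the Wick-rotated metric `g_W` is pointwise linear algebra. On a causal
vector `v` one has `g_W(v, v) ≤ 2 dτ(v) ^ 2` because `g(v, v) ≤ 0`, so that `τ` is steep for `g_W / 2`
as soon as `dτ > 0` on the future cones (`isSteep_half_wick`). Conversely the unit normal `N'` and the
vectors `β N' ± u`, with `u` tangent to the level and `β` the `g_W`-norm of `u`, are causal, and they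
span; if `τ` is `h`-steep, this gives `h ≤ 2 g_W` (`IsSteep.inner_le_wick`). A metric which dominates
a complete metric is complete (`IsComplete.of_inner_le`), whence the equivalence.

The sign of `dτ` is not part of the definition of a temporal function. It comes from the fact that
`τ` increases along the straight segments of a chart with timelike direction; at a boundary point,
one of the two halves of such a segment stays in the manifold (`IsTemporal.diff_pos`).

For the Cauchy property, let `γ` be a future causal curve. Steepness bounds the speed of `γ` by the
derivative of `τ ∘ γ`, and hence the distance of `γ a` and `γ b` by the increment of `τ`, up to a
factor `2` (`IsSteep.riemDist_le`). As the Riemannian distance is defined by `C^1` paths whereas `γ`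
is only locally Lipschitz, this is obtained by differentiating the distance to a point along `γ`,
which is a Lipschitz function (`riemannianEDist_le_of_lipschitz`). If `τ` is bounded above (below)
along `γ`, then `γ` is Cauchy in the future (past), and by completeness it has an endpoint. Thus `τ`
takes all values on an inextensible curve, each of them once.
-/

namespace Wick

/-! ### Straight lines in charts and the Riemannian distance -/

section Riemannian

open scoped NNReal

theorem contMDiff_add_smul {E : Type*} [NormedAddCommGroup E] [NormedSpace ℝ E] (q w : E) :
    ContMDiff 𝓘(ℝ, ℝ) 𝓘(ℝ, E) 1 (fun t : ℝ => q + t • w) := by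
  rw [contMDiff_iff_contDiff]
  fun_prop

variable {E : Type*} [NormedAddCommGroup E] [NormedSpace ℝ E]
  {H : Type*} [TopologicalSpace H] {I : ModelWithCorners ℝ E H}
  {M : Type*} [TopologicalSpace M] [ChartedSpace H M] [IsManifold I 1 M]

/-- At a point `q` of the target of the chart at `x`, the derivative of the inverse chart is the
inverse of the trivialization of the tangent bundle. -/
theorem mfderivWithin_extChartAt_symm_apply (x : M) {q : E} (hq : q ∈ (extChartAt I x).target)
    (w : E) : mfderivWithin 𝓘(ℝ, E) I (extChartAt I x).symm (range I) q w =
      (trivializationAt E (TangentSpace I) x).symmL ℝ ((extChartAt I x).symm q) w := by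
  have hsrc : (extChartAt I x).symm q ∈ (chartAt H x).source := by
    simpa [extChartAt_source] using (extChartAt I x).map_target hq
  have key : ∀ q', q' = q → (mfderivWithin 𝓘(ℝ, E) I (extChartAt I x).symm (range I) q' :
      E →L[ℝ] E) = mfderivWithin 𝓘(ℝ, E) I (extChartAt I x).symm (range I) q := by
    rintro _ rfl; rfl
  have h1 := key _ ((extChartAt I x).right_inv hq)
  have h2 := TangentBundle.symmL_trivializationAt (I := I) (𝕜 := ℝ) hsrc
  have h3 : (((trivializationAt E (TangentSpace I) x).symmL ℝ ((extChartAt I x).symm q) :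
      E →L[ℝ] E)) = mfderivWithin 𝓘(ℝ, E) I (extChartAt I x).symm (range I) q := h2.trans h1
  exact (congrArg (fun L : E →L[ℝ] E => L w) h3).symm

/-- The trivialization of the tangent bundle at `x` is the identity over `x`. -/
theorem symmL_trivializationAt_self (x : M) (v : E) :
    (trivializationAt E (TangentSpace I) x).symmL ℝ x v = (v : TangentSpace I x) := by
  rw [TangentBundle.symmL_trivializationAt_eq_core (mem_chart_source H x)]
  exact (tangentBundleCore I M).coordChange_self _ _ (mem_chart_source H x) _

/-- The curve which is the straight line `t ↦ q + t w` in the chart at `x`. It is meaningful as long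
as the line stays in the target of the chart. -/
def chartLine (I : ModelWithCorners ℝ E H) (x : M) (q w : E) (t : ℝ) : M :=
  (extChartAt I x).symm (q + t • w)

theorem contMDiffOn_chartLine {x : M} {q w : E} {J : Set ℝ}
    (hJ : ∀ t ∈ J, q + t • w ∈ (extChartAt I x).target) :
    ContMDiffOn 𝓘(ℝ, ℝ) I 1 (chartLine I x q w) J :=
  (contMDiffOn_extChartAt_symm x).comp (contMDiff_add_smul q w).contMDiffOn hJ

theorem mfderivWithin_chartLine {x : M} {q w : E} {J : Set ℝ}
    (hJ : ∀ t ∈ J, q + t • w ∈ (extChartAt I x).target) {t : ℝ} (ht : t ∈ J)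
    (hu : UniqueDiffWithinAt ℝ J t) :
    mfderivWithin 𝓘(ℝ, ℝ) I (chartLine I x q w) J t (1 : ℝ) =
      (trivializationAt E (TangentSpace I) x).symmL ℝ (chartLine I x q w t) w := by
  have h5 : mfderivWithin 𝓘(ℝ, ℝ) I (chartLine I x q w) J t =
      (mfderivWithin 𝓘(ℝ, E) I (extChartAt I x).symm (range I) (q + t • w)) ∘L
        (mfderivWithin 𝓘(ℝ, ℝ) 𝓘(ℝ, E) (fun t : ℝ => q + t • w) J t) := by
    apply mfderivWithin_comp (g := (extChartAt I x).symm) (f := fun t : ℝ => q + t • w)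
    · exact mdifferentiableWithinAt_extChartAt_symm (hJ t ht)
    · exact (contMDiff_add_smul q w).contMDiffOn.mdifferentiableOn one_ne_zero t ht
    · exact fun s hs => extChartAt_target_subset_range x (hJ s hs)
    · rwa [uniqueMDiffWithinAt_iff_uniqueDiffWithinAt]
  have h6 : mfderivWithin 𝓘(ℝ, ℝ) 𝓘(ℝ, E) (fun t : ℝ => q + t • w) J t (1 : ℝ) = (w : E) := by
    rw [mfderivWithin_eq_fderivWithin]
    have : HasDerivWithinAt (fun t : ℝ => q + t • w) w J t := by
      simpa using (((hasDerivAt_id t).smul_const w).const_add q).hasDerivWithinAt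
    exact this.derivWithin hu
  rw [h5]
  refine Eq.trans ?_ (mfderivWithin_extChartAt_symm_apply x (hJ t ht) w)
  exact congrArg _ h6

variable [RiemannianBundle (fun x : M => TangentSpace I x)]
  [IsContinuousRiemannianBundle E (fun x : M => TangentSpace I x)]

/-- Near `x`, the Riemannian distance is at most `c > 1` times the distance in the chart at `x`
measured with the scalar product of `T_x M`: the segment between two points in the chart is a path
of at most this length. -/
theorem exists_nhds_riemannianEDist_le (x : M) {c : ℝ≥0} (hc : 1 < c) :
    ∃ U ∈ 𝓝 x, ∀ y ∈ U, ∀ z ∈ U, riemannianEDist I y z ≤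
      c * ‖(trivializationAt E (TangentSpace I) x).symmL ℝ x
        (extChartAt I x z - extChartAt I x y)‖ₑ := by
  set e := trivializationAt E (TangentSpace I) x
  have hx : x ∈ e.baseSet := FiberBundle.mem_baseSet_trivializationAt' x
  have h1 : ∀ᶠ y in 𝓝 x, ∀ w : E, ‖e.symmL ℝ y w‖ₑ ≤ c * ‖e.symmL ℝ x w‖ₑ := by
    filter_upwards [eventually_norm_symmL_trivializationAt_comp_self_lt E
      (fun x : M => TangentSpace I x) x (r := c) (by exact_mod_cast hc)] with y hy w
    have h2 := ContinuousLinearMap.le_of_opNorm_le _ hy.le (e.symmL ℝ x w)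
    have h3 : ((e.symmL ℝ y) ∘L (e.continuousLinearMapAt ℝ x)) (e.symmL ℝ x w) =
        e.symmL ℝ y w := by
      rw [ContinuousLinearMap.comp_apply, e.continuousLinearMapAt_symmL (R := ℝ) hx]
    change ‖((e.symmL ℝ y) ∘L (e.continuousLinearMapAt ℝ x)) (e.symmL ℝ x w)‖ ≤ _ at h2
    rw [h3] at h2
    rw [← ofReal_norm, ← ofReal_norm, ← ENNReal.ofReal_coe_nnreal,
      ← ENNReal.ofReal_mul c.coe_nonneg]
    exact ENNReal.ofReal_le_ofReal h2
  have h2 : ∀ᶠ q in 𝓝[range I] (extChartAt I x x), ∀ w : E,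
      ‖e.symmL ℝ ((extChartAt I x).symm q) w‖ₑ ≤ c * ‖e.symmL ℝ x w‖ₑ := by
    have hcont : ContinuousAt (extChartAt I x).symm (extChartAt I x x) :=
      continuousAt_extChartAt_symm _
    rw [ContinuousAt, extChartAt_to_inv] at hcont
    exact nhdsWithin_le_nhds (hcont.eventually h1)
  obtain ⟨r, r_pos, hr⟩ := Metric.mem_nhdsWithin_iff.1
    (inter_mem (extChartAt_target_mem_nhdsWithin x) h2)
  have hA : (extChartAt I x) ⁻¹' (Metric.ball (extChartAt I x x) r ∩ range I) ∈ 𝓝 x := by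
    apply extChartAt_preimage_mem_nhds_of_mem_nhdsWithin (by simp)
    rw [inter_comm]
    exact inter_mem_nhdsWithin _ (Metric.ball_mem_nhds _ r_pos)
  refine ⟨_, inter_mem hA (extChartAt_source_mem_nhds (I := I) x), ?_⟩
  rintro y ⟨hy, hys⟩ z ⟨hz, hzs⟩
  set w := extChartAt I x z - extChartAt I x y with hw
  have hη : ∀ t ∈ Icc (0 : ℝ) 1, extChartAt I x y + t • w ∈ (extChartAt I x).target ∩
      {q | ∀ w : E, ‖e.symmL ℝ ((extChartAt I x).symm q) w‖ₑ ≤ c * ‖e.symmL ℝ x w‖ₑ} := by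
    intro t ht
    refine hr (((convex_ball _ _).inter I.convex_range).segment_subset hy hz ?_)
    rw [segment_eq_image']
    exact ⟨t, ht, rfl⟩
  have hη' := fun t ht => (hη t ht).1
  have h3 : riemannianEDist I y z ≤ pathELength I (chartLine I x (extChartAt I x y) w) 0 1 := by
    apply riemannianEDist_le_pathELength (contMDiffOn_chartLine hη') _ _ zero_le_one
    · rw [chartLine, zero_smul, add_zero, (extChartAt I x).left_inv hys]
    · rw [chartLine, one_smul, hw, add_sub_cancel, (extChartAt I x).left_inv hzs]
  refine h3.trans ?_
  rw [pathELength_eq_lintegral_mfderivWithin_Icc]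
  calc _ ≤ ∫⁻ _ in Icc (0 : ℝ) 1, c * ‖e.symmL ℝ x w‖ₑ := by
        refine setLIntegral_mono' measurableSet_Icc fun t ht => ?_
        have h4 : mfderivWithin 𝓘(ℝ, ℝ) I (chartLine I x (extChartAt I x y) w) (Icc 0 1) t (1 : ℝ) =
            e.symmL ℝ (chartLine I x (extChartAt I x y) w t) w :=
          mfderivWithin_chartLine hη' ht (uniqueDiffOn_Icc zero_lt_one t ht)
        exact (congrArg enorm h4).trans_le ((hη t ht).2 w)
    _ = c * ‖e.symmL ℝ x w‖ₑ := by
        rw [setLIntegral_const]; simp [-extChartAt]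

end Riemannian

/-! ### The Riemannian distance along locally Lipschitz curves -/

section RiemannianCurve

open scoped NNReal

variable {E : Type*} [NormedAddCommGroup E] [NormedSpace ℝ E]
  {H : Type*} [TopologicalSpace H] {I : ModelWithCorners ℝ E H}
  {M : Type*} [TopologicalSpace M] [ChartedSpace H M]

/-- The velocity of a curve, read in the chart at the point it passes through. -/
theorem hasDerivAt_extChartAt_comp {γ : ℝ → M} {t : ℝ}
    (hγ : MDifferentiableAt 𝓘(ℝ, ℝ) I γ t) :
    HasDerivAt (fun s => extChartAt I (γ t) (γ s)) (mfderiv 𝓘(ℝ, ℝ) I γ t (1 : ℝ) : E) t := by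
  have h := hγ.hasMFDerivAt.2
  rw [modelWithCornersSelf_coe, range_id] at h
  let L : ℝ →L[ℝ] E := mfderiv 𝓘(ℝ, ℝ) I γ t
  have h' : HasFDerivWithinAt (fun s => extChartAt I (γ t) (γ s)) L univ t := h
  exact (hasFDerivWithinAt_univ.1 h').hasDerivAt

/-- Derivatives inherit a comparison of increments. -/
theorem norm_deriv_le_of_eventually_norm_sub_le {F G : Type*} [NormedAddCommGroup F]
    [NormedSpace ℝ F] [NormedAddCommGroup G] [NormedSpace ℝ G] {D : ℝ → F} {ψ : ℝ → G} {t : ℝ}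
    {D' : F} {v : G} {c : ℝ} (hD : HasDerivAt D D' t) (hψ : HasDerivAt ψ v t)
    (h : ∀ᶠ s in 𝓝 t, ‖D s - D t‖ ≤ c * ‖ψ s - ψ t‖) : ‖D'‖ ≤ c * ‖v‖ := by
  refine le_of_tendsto_of_tendsto hD.tendsto_slope.norm (hψ.tendsto_slope.norm.const_mul c) ?_
  filter_upwards [nhdsWithin_le_nhds h] with s hs
  simp only [slope, vsub_eq_sub, norm_smul]
  calc _ ≤ ‖(s - t)⁻¹‖ * (c * ‖ψ s - ψ t‖) := by gcongr
    _ = _ := by ring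

variable [RiemannianBundle (fun x : M => TangentSpace I x)]

/-- Triangle inequality for the real-valued distance to a point at finite distance. -/
theorem abs_toReal_riemannianEDist_sub_le {x y z : M} (hy : riemannianEDist I x y ≠ ⊤)
    (hz : riemannianEDist I x z ≠ ⊤) (hyz : riemannianEDist I y z ≠ ⊤) :
    |(riemannianEDist I x y).toReal - (riemannianEDist I x z).toReal| ≤
      (riemannianEDist I y z).toReal := by
  have h1 : (riemannianEDist I x y).toReal ≤
      (riemannianEDist I x z).toReal + (riemannianEDist I y z).toReal := by
    rw [← ENNReal.toReal_add hz hyz]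
    refine ENNReal.toReal_mono (ENNReal.add_ne_top.2 ⟨hz, hyz⟩) ?_
    rw [riemannianEDist_comm (x := y)]
    exact riemannianEDist_triangle
  have h2 : (riemannianEDist I x z).toReal ≤
      (riemannianEDist I x y).toReal + (riemannianEDist I y z).toReal := by
    rw [← ENNReal.toReal_add hy hyz]
    exact ENNReal.toReal_mono (ENNReal.add_ne_top.2 ⟨hy, hyz⟩) riemannianEDist_triangle
  rw [abs_le]
  constructor <;> linarith

variable [IsManifold I 1 M] [IsContinuousRiemannianBundle E (fun x : M => TangentSpace I x)]

/-- If a curve which is Lipschitz for the Riemannian distance has speed at most `f'` almost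
everywhere, with `f` monotone, then the distance between its endpoints is controlled by the
increment of `f`. The function `f` need not be absolutely continuous; the distance to the initial
point is. -/
theorem riemannianEDist_le_of_lipschitz {γ : ℝ → M} {f : ℝ → ℝ} {a b : ℝ} (hab : a ≤ b)
    (hf : MonotoneOn f (Icc a b)) {K : ℝ≥0}
    (hK : ∀ s ∈ Icc a b, ∀ t ∈ Icc a b, riemannianEDist I (γ s) (γ t) ≤ K * edist s t)
    (hv : ∀ᵐ t ∂(volume.restrict (Icc a b)), MDifferentiableAt 𝓘(ℝ, ℝ) I γ t ∧
      ‖mfderiv 𝓘(ℝ, ℝ) I γ t (1 : ℝ)‖ ≤ deriv f t) :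
    riemannianEDist I (γ a) (γ b) ≤ ENNReal.ofReal (2 * (f b - f a)) := by
  have hfin : ∀ s ∈ Icc a b, ∀ t ∈ Icc a b, riemannianEDist I (γ s) (γ t) ≠ ⊤ := fun s hs t ht =>
    ne_top_of_le_ne_top (ENNReal.mul_ne_top ENNReal.coe_ne_top (edist_ne_top s t)) (hK s hs t ht)
  have ha : a ∈ Icc a b := left_mem_Icc.2 hab
  have hb : b ∈ Icc a b := right_mem_Icc.2 hab
  set D : ℝ → ℝ := fun s => (riemannianEDist I (γ a) (γ s)).toReal with hD
  have hDsub : ∀ s ∈ Icc a b, ∀ t ∈ Icc a b,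
      |D s - D t| ≤ (riemannianEDist I (γ s) (γ t)).toReal := fun s hs t ht =>
    abs_toReal_riemannianEDist_sub_le (hfin a ha s hs) (hfin a ha t ht) (hfin s hs t ht)
  have hDlip : LipschitzOnWith K D (uIcc a b) := by
    rw [uIcc_of_le hab]
    refine LipschitzOnWith.of_dist_le_mul fun s hs t ht => ?_
    rw [Real.dist_eq]
    refine (hDsub s hs t ht).trans ?_
    have := ENNReal.toReal_mono (ENNReal.mul_ne_top ENNReal.coe_ne_top (edist_ne_top s t))
      (hK s hs t ht)
    rwa [ENNReal.toReal_mul, ENNReal.coe_toReal, ← dist_edist] at this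
  have hDac := hDlip.absolutelyContinuousOnInterval
  have hderiv : ∀ᵐ t ∂(volume.restrict (Icc a b)), deriv D t ≤ 2 * deriv f t := by
    rw [← restrict_Ioo_eq_restrict_Icc] at hv ⊢
    rw [ae_restrict_iff' measurableSet_Ioo] at hv ⊢
    filter_upwards [hv, hDac.ae_differentiableAt] with t h1 h2 ht
    have htI : t ∈ Icc a b := Ioo_subset_Icc_self ht
    obtain ⟨h3, h4⟩ := h1 ht
    have h5 := (h2 (by rwa [uIcc_of_le hab])).hasDerivAt
    obtain ⟨U, hU, hUd⟩ := exists_nhds_riemannianEDist_le (I := I) (γ t) (c := 2) one_lt_two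
    set L := (trivializationAt E (TangentSpace I) (γ t)).symmL ℝ (γ t)
    have h6 : HasDerivAt (fun s => L (extChartAt I (γ t) (γ s)))
        (mfderiv 𝓘(ℝ, ℝ) I γ t (1 : ℝ)) t := by
      exact (L.hasFDerivAt.comp_hasDerivAt t (hasDerivAt_extChartAt_comp h3)).congr_deriv
        (symmL_trivializationAt_self _ _)
    have h7 : ‖deriv D t‖ ≤ 2 * ‖mfderiv 𝓘(ℝ, ℝ) I γ t (1 : ℝ)‖ := by
      refine norm_deriv_le_of_eventually_norm_sub_le h5 h6 ?_
      filter_upwards [h3.continuousAt.preimage_mem_nhds hU, Icc_mem_nhds ht.1 ht.2] with s hs hsI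
      rw [Real.norm_eq_abs]
      refine (hDsub s hsI t htI).trans ?_
      have := hUd _ (mem_of_mem_nhds hU) _ hs
      rw [riemannianEDist_comm] at this
      have := ENNReal.toReal_mono (by finiteness) this
      rw [ENNReal.toReal_mul, toReal_enorm, map_sub] at this
      exact this
    calc deriv D t ≤ ‖deriv D t‖ := Real.le_norm_self _
      _ ≤ _ := h7
      _ ≤ _ := by gcongr
  have hf' : MonotoneOn f (uIcc a b) := by rwa [uIcc_of_le hab]
  have h1 : ∫ t in a..b, deriv D t ≤ ∫ t in a..b, 2 * deriv f t :=
    intervalIntegral.integral_mono_ae_restrict hab hDac.intervalIntegrable_deriv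
      (hf'.intervalIntegrable_deriv.const_mul 2) hderiv
  have h2 := hf'.intervalIntegral_deriv_mem_uIcc
  rw [uIcc_of_le (sub_nonneg.2 (hf ha hb hab))] at h2
  rw [hDac.integral_deriv_eq_sub, intervalIntegral.integral_const_mul] at h1
  have h3 : D a = 0 := by simp [hD, riemannianEDist_self]
  refine (ENNReal.le_ofReal_iff_toReal_le (hfin a ha b hb) ?_).2 ?_
  · linarith [h2.1, h2.2]
  · change D b ≤ _
    linarith [h2.2]

/-- A curve which is Lipschitz in a chart is locally Lipschitz for the Riemannian distance. -/
theorem exists_nhdsWithin_riemannianEDist_le {γ : ℝ → M} {J : Set ℝ} {t : ℝ} {K : ℝ≥0} {W : Set ℝ}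
    (hγ : ContinuousWithinAt γ J t) (hW : W ∈ 𝓝[J] t)
    (hK : LipschitzOnWith K (fun s => extChartAt I (γ t) (γ s)) W) :
    ∃ V ∈ 𝓝[J] t, ∃ K' : ℝ≥0, ∀ s ∈ V, ∀ s' ∈ V,
      riemannianEDist I (γ s) (γ s') ≤ K' * edist s s' := by
  obtain ⟨U, hU, hUd⟩ := exists_nhds_riemannianEDist_le (I := I) (γ t) (c := 2) one_lt_two
  set L := (trivializationAt E (TangentSpace I) (γ t)).symmL ℝ (γ t)
  refine ⟨W ∩ γ ⁻¹' U, inter_mem hW (hγ.preimage_mem_nhdsWithin hU), 2 * (‖L‖₊ * K), ?_⟩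
  rintro s ⟨hs, hsU⟩ s' ⟨hs', hsU'⟩
  refine (hUd _ hsU _ hsU').trans ?_
  push_cast
  rw [mul_assoc, mul_assoc]
  gcongr
  refine (L.le_opENorm _).trans ?_
  refine mul_le_mul' le_rfl ?_
  rw [← edist_eq_enorm_sub, edist_comm s s']
  exact hK hs' hs

/-- A locally Lipschitz curve whose speed is almost everywhere at most `f'`, with `f` monotone, has
endpoints at distance controlled by the increment of `f`. -/
theorem riemannianEDist_le_of_speed_le {γ : ℝ → M} {f : ℝ → ℝ} {a b : ℝ} (hab : a ≤ b)
    (hf : MonotoneOn f (Icc a b)) (hγ : ContinuousOn γ (Icc a b))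
    (hL : ∀ t ∈ Icc a b, ∃ K, ∃ W ∈ 𝓝[Icc a b] t,
      LipschitzOnWith K (fun s => extChartAt I (γ t) (γ s)) W)
    (hv : ∀ᵐ t ∂(volume.restrict (Icc a b)), MDifferentiableAt 𝓘(ℝ, ℝ) I γ t ∧
      ‖mfderiv 𝓘(ℝ, ℝ) I γ t (1 : ℝ)‖ ≤ deriv f t) :
    riemannianEDist I (γ a) (γ b) ≤ ENNReal.ofReal (2 * (f b - f a)) := by
  have h1 : ∀ t : Icc a b, ∃ V ∈ 𝓝[Icc a b] (t : ℝ), ∃ K' : ℝ≥0, ∀ s ∈ V, ∀ s' ∈ V,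
      riemannianEDist I (γ s) (γ s') ≤ K' * edist s s' := by
    intro t
    obtain ⟨K, W, hW, hK⟩ := hL t t.2
    exact exists_nhdsWithin_riemannianEDist_le (hγ t t.2) hW hK
  choose V hV K hK using h1
  have h2 : ∀ t : Icc a b, ∃ O : Set (Icc a b), O ⊆ Subtype.val ⁻¹' V t ∧ IsOpen O ∧ t ∈ O := by
    intro t
    have : Subtype.val ⁻¹' V t ∈ 𝓝 t := by
      rw [nhds_subtype_eq_comap_nhdsWithin]
      exact preimage_mem_comap (hV t)
    exact mem_nhds_iff.1 this
  choose O hOV hO htO using h2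
  obtain ⟨u, hu0, hum, ⟨m, hm⟩, hu⟩ := exists_monotone_Icc_subset_open_cover_Icc hab hO
    (fun t _ => mem_iUnion.2 ⟨t, htO t⟩)
  have h3 : ∀ n, riemannianEDist I (γ a) (γ (u n)) ≤ ENNReal.ofReal (2 * (f (u n) - f a)) := by
    intro n
    induction n with
    | zero => simp [hu0, riemannianEDist_self]
    | succ n ih =>
      obtain ⟨i, hi⟩ := hu n
      have hle : (u n : ℝ) ≤ u (n + 1) := hum n.le_succ
      have hsub : Icc (u n : ℝ) (u (n + 1)) ⊆ Icc a b := Icc_subset_Icc (u n).2.1 (u (n + 1)).2.2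
      have hV : ∀ s ∈ Icc (u n : ℝ) (u (n + 1)), s ∈ V i := fun s hs =>
        hOV i (hi (show (⟨s, hsub hs⟩ : Icc a b) ∈ Icc (u n) (u (n + 1)) from hs))
      have h4 := riemannianEDist_le_of_lipschitz (I := I) hle (hf.mono hsub)
        (fun s hs t ht => hK i s (hV s hs) t (hV t ht)) (ae_restrict_of_ae_restrict_of_subset hsub hv)
      refine riemannianEDist_triangle.trans ((add_le_add ih h4).trans ?_)
      have h5 := hf (left_mem_Icc.2 hab) (u n).2 (u n).2.1
      have h6 := hf (u n).2 (u (n + 1)).2 hle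
      rw [← ENNReal.ofReal_add (by linarith) (by linarith)]
      exact ENNReal.ofReal_le_ofReal (by linarith)
  simpa [hm m le_rfl] using h3 m

end RiemannianCurve

/-! ### Linear algebra of the causal cone -/

section CausalCone

variable {V : Type*} [AddCommGroup V] [Module ℝ V] [TopologicalSpace V]

/-- A nonzero vector orthogonal to a timelike vector is not causal, so that a timelike vector is
never orthogonal to a nonzero causal vector. -/
theorem IsLorentzOn.apply_ne_zero {b : V →L[ℝ] V →L[ℝ] ℝ} (hs : ∀ v w, b v w = b w v)
    (hb : IsLorentzOn b ⊤) {N w : V} (hN : b N N < 0) (hw : w ≠ 0) (hww : b w w ≤ 0) :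
    b N w ≠ 0 := fun h => hww.not_gt (hb.pos_of_orthogonal hs hN h hw)

/-- A linear form represented by a timelike vector `N` has constant sign on the causal cone of the
timelike vector `T`. -/
theorem IsLorentzOn.pos_of_causal {b : V →L[ℝ] V →L[ℝ] ℝ} (hs : ∀ v w, b v w = b w v)
    (hb : IsLorentzOn b ⊤) {N T v : V} (hN : b N N < 0) (hT : b T T < 0) (hNT : 0 < b N T)
    (hvv : b v v ≤ 0) (hTv : b T v < 0) : 0 < b N v := by
  by_contra! hcon
  -- the causal cone is convex: this combination of `T` and `v` is causal and orthogonal to `N`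
  set w := b N T • v - b N v • T with hw
  have h0 : b N w = 0 := by simp [hw]; ring
  have h1 : b T w < 0 := by
    simp only [hw, map_sub, map_smul, smul_eq_mul]
    nlinarith [mul_neg_of_pos_of_neg hNT hTv, mul_nonneg_of_nonpos_of_nonpos hcon hT.le]
  have hw0 : w ≠ 0 := by
    intro h
    rw [h, map_zero] at h1
    exact lt_irrefl _ h1
  refine hb.apply_ne_zero hs hN hw0 ?_ h0
  have h2 : b w w = b N T ^ 2 * b v v + 2 * (b N T * (-b N v)) * b T v + b N v ^ 2 * b T T := by
    simp [hw, hs v T]; ring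
  rw [h2]
  have h3 : 2 * (b N T * (-b N v)) * b T v ≤ 0 :=
    mul_nonpos_of_nonneg_of_nonpos (by have := mul_nonneg hNT.le (neg_nonneg.2 hcon); linarith)
      hTv.le
  nlinarith [mul_nonneg (sq_nonneg (b N T)) (neg_nonneg.2 hvv),
    mul_nonneg (sq_nonneg (b N v)) (neg_nonneg.2 hT.le)]

/-- A nonnegative quadratic form `h` which is bounded by the square of `φ = b N` on causal vectors
is bounded by twice the Wick-rotated form. The form `h` is controlled on the unit normal `N'`, and
on the orthogonal complement of `N` because `u` is half of the difference of the two null vectors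
`β N' ± u`, where `β ^ 2 = -φ N * b u u`. -/
theorem form_le_of_le_on_causal {b h : V →L[ℝ] V →L[ℝ] ℝ} {N : V} (hs : ∀ v w, b v w = b w v)
    (hb : IsLorentzOn b ⊤) (hsh : ∀ v w, h v w = h w v) (hN : b N N < 0) (hpos : ∀ v, 0 ≤ h v v)
    (hc : ∀ v, b v v ≤ 0 → h v v ≤ b N v ^ 2) (w : V) :
    h w w ≤ 2 * (-(b N N) * b w w + 2 * (b N w * b N w)) := by
  obtain ⟨q, hq⟩ : ∃ q, q = b N N := ⟨_, rfl⟩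
  rw [← hq] at hN ⊢
  set N' := q⁻¹ • N with hN'
  set a := b N w with ha
  set u := w - a • N' with hu
  have hNN' : b N N' = 1 := by simp [hN', ← hq, hN.ne]
  have hN'N' : b N' N' = q⁻¹ := by simp [hN', ← hq, hN.ne]
  have hNu : b N u = 0 := by simp [hu, hNN', ha]
  have hN'u : b N' u = 0 := by simp [hN', hNu]
  have huN' : b u N' = 0 := by rw [hs]; exact hN'u
  have huu : 0 ≤ b u u := by
    by_cases h0 : u = 0
    · simp [h0]
    · exact (hb.pos_of_orthogonal hs (hq ▸ hN) hNu h0).le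
  have hw : w = a • N' + u := by simp [hu]
  have hww : b w w = a ^ 2 * q⁻¹ + b u u := by
    rw [hw]; simp [hN'N', hN'u, huN']; ring
  obtain ⟨β, hβ⟩ : ∃ β, β = √(-q * b u u) := ⟨_, rfl⟩
  have hβ2 : β ^ 2 = -q * b u u := by
    rw [hβ]; exact Real.sq_sqrt (mul_nonneg (by linarith) huu)
  have hβq : β ^ 2 * q⁻¹ = - b u u := by
    rw [hβ2]; field_simp [hN.ne]
  have hplus := hc (β • N' + u) (by
    have : b (β • N' + u) (β • N' + u) = β ^ 2 * q⁻¹ + b u u := by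
      simp [hN'N', hN'u, huN']; ring
    rw [this, hβq]; simp)
  have hminus := hc (β • N' - u) (by
    have : b (β • N' - u) (β • N' - u) = β ^ 2 * q⁻¹ + b u u := by
      simp [hN'N', hN'u, huN']; ring
    rw [this, hβq]; simp)
  have hh := hc N' (by rw [hN'N']; exact (inv_lt_zero.2 hN).le)
  have e1 : b N (β • N' + u) = β := by simp [hNN', hNu]
  have e2 : b N (β • N' - u) = β := by simp [hNN', hNu]
  rw [e1] at hplus
  rw [e2] at hminus
  rw [hNN'] at hh
  have p1 : h (β • N' + u) (β • N' + u) = β ^ 2 * h N' N' + 2 * β * h N' u + h u u := by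
    simp [hsh u N']; ring
  have p2 : h (β • N' - u) (β • N' - u) = β ^ 2 * h N' N' - 2 * β * h N' u + h u u := by
    simp [hsh u N']; ring
  have p3 : h (a • N' - u) (a • N' - u) = a ^ 2 * h N' N' - 2 * a * h N' u + h u u := by
    simp [hsh u N']; ring
  have p4 : h w w = a ^ 2 * h N' N' + 2 * a * h N' u + h u u := by
    rw [hw]; simp [hsh u N']; ring
  have p5 := hpos (a • N' - u)
  rw [p1] at hplus
  rw [p2] at hminus
  rw [p3] at p5
  have hu2 : h u u ≤ β ^ 2 := by linarith [mul_nonneg (sq_nonneg β) (hpos N')]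
  have ha2 : a ^ 2 * h N' N' ≤ a ^ 2 := mul_le_of_le_one_right (sq_nonneg a) (by linarith)
  have hq2 : -q * (a ^ 2 * q⁻¹ + b u u) = - a ^ 2 + β ^ 2 := by
    rw [hβ2]; field_simp [hN.ne]; ring
  rw [hww, neg_mul, ← neg_mul, hq2, p4]
  linarith

end CausalCone

/-! ### Comparison of a steep metric with the Wick-rotated metric -/

namespace Spacetime

variable {n : ℕ} {r : ℕ∞} {M : Type*} [TopologicalSpace M]
  [ChartedSpace (EuclideanHalfSpace (n + 1)) M] [IsManifold (𝓡∂ (n + 1)) 1 M]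

theorem riemDist_eq_iInf (h : RiemMetric n r M) (x y : M) :
    riemDist h x y = ⨅ (γ : Path x y) (_ : ContMDiff (𝓡∂ 1) (𝓡∂ (n + 1)) 1 γ),
      ∫⁻ t, ENNReal.ofReal √(h.inner (γ t) (mfderiv (𝓡∂ 1) (𝓡∂ (n + 1)) γ t 1)
        (mfderiv (𝓡∂ 1) (𝓡∂ (n + 1)) γ t 1)) := by
  let : RiemannianBundle (fun x : M => TangentSpace (𝓡∂ (n + 1)) x) := ⟨h.toRiemannianMetric⟩
  change riemannianEDist (𝓡∂ (n + 1)) x y = _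
  rw [riemannianEDist_def]
  congr! with γ hγ t
  rw [← ofReal_norm, norm_eq_sqrt_real_inner]
  rfl

/-- A pointwise comparison of Riemannian metrics gives a comparison of their distances. -/
theorem riemDist_le_of_inner_le {h k : RiemMetric n r M} {C : ℝ} (hC : 0 < C)
    (hhk : ∀ x v, h.inner x v v ≤ C ^ 2 * k.inner x v v) (x y : M) :
    riemDist h x y ≤ ENNReal.ofReal C * riemDist k x y := by
  have hC0 : ENNReal.ofReal C ≠ 0 := by simpa using hC
  rw [riemDist_eq_iInf, riemDist_eq_iInf, ENNReal.mul_iInf_of_ne hC0 ENNReal.ofReal_ne_top]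
  refine le_iInf fun γ => ?_
  rw [ENNReal.mul_iInf_of_ne hC0 ENNReal.ofReal_ne_top]
  refine le_iInf fun hγ => (iInf₂_le γ hγ).trans ?_
  rw [← lintegral_const_mul' _ _ ENNReal.ofReal_ne_top]
  refine lintegral_mono fun t => ?_
  rw [← ENNReal.ofReal_mul hC.le]
  refine ENNReal.ofReal_le_ofReal ?_
  nth_rw 1 [← Real.sqrt_sq hC.le]
  rw [← Real.sqrt_mul (sq_nonneg C)]
  exact Real.sqrt_le_sqrt (hhk _ _)

/-- A Riemannian metric which dominates a complete one is complete. -/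
theorem IsComplete.of_inner_le {h k : RiemMetric n r M} (hh : IsComplete h) {C : ℝ} (hC : 0 < C)
    (hhk : ∀ x v, h.inner x v v ≤ C ^ 2 * k.inner x v v) : IsComplete k := by
  intro u hu
  refine hh u fun ε hε => ?_
  have hC0 : ENNReal.ofReal C ≠ 0 := by simpa using hC
  obtain ⟨N, hN⟩ := hu (ε / ENNReal.ofReal C) (ENNReal.div_pos hε.ne' ENNReal.ofReal_ne_top)
  refine ⟨N, fun i hi j hj => (riemDist_le_of_inner_le hC hhk _ _).trans_lt ?_⟩
  have := hN i hi j hj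
  rwa [ENNReal.lt_div_iff_mul_lt (Or.inl hC0) (Or.inl ENNReal.ofReal_ne_top), mul_comm] at this

variable (S : Spacetime n r M)

theorem exists_timelike (x : M) : ∃ T : TangentSpace (𝓡∂ (n + 1)) x, S.val x T T < 0 ∧
    S.future x = {v | v ≠ 0 ∧ S.val x v v ≤ 0 ∧ S.val x T v < 0} := by
  obtain ⟨U, hU, T, -, hT⟩ := S.time_oriented x
  exact ⟨T x, hT x (mem_of_mem_nhds hU)⟩

/-- A nonzero causal vector is future or past. -/
theorem mem_future_or_neg_mem {x : M} {v : TangentSpace (𝓡∂ (n + 1)) x} (hv : v ≠ 0)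
    (hvv : S.val x v v ≤ 0) : v ∈ S.future x ∨ -v ∈ S.future x := by
  obtain ⟨T, hT, hfut⟩ := S.exists_timelike x
  rw [hfut]
  rcases lt_or_gt_of_ne ((S.lorentz x).apply_ne_zero (S.symm x) hT hv hvv) with h | h
  · exact Or.inl ⟨hv, hvv, h⟩
  · exact Or.inr ⟨neg_ne_zero.2 hv, by simpa using hvv, by simpa using h⟩

/-- Steepness bounds the metric by `dτ ^ 2` on all causal vectors. -/
theorem IsSteep.inner_le_sq {S : Spacetime n r M} {h : RiemMetric n r M} {τ : M → ℝ}
    (hτ : S.IsSteep h τ) {x : M} {v : TangentSpace (𝓡∂ (n + 1)) x} (hvv : S.val x v v ≤ 0) :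
    h.inner x v v ≤ diff τ x v ^ 2 := by
  rcases eq_or_ne v 0 with rfl | hv
  · simp
  rcases S.mem_future_or_neg_mem hv hvv with hf | hf
  · exact Real.sqrt_le_left (Real.sqrt_nonneg _ |>.trans (hτ.2 x v hf)) |>.1 (hτ.2 x v hf)
  · have := Real.sqrt_le_left (Real.sqrt_nonneg _ |>.trans (hτ.2 x _ hf)) |>.1 (hτ.2 x _ hf)
    simpa using this

section Wick

variable [IsManifold (𝓡∂ (n + 1)) ((r : ℕ∞ω) + 1) M] {S} {τ : M → ℝ}

/-- If `τ` is `h`-steep, then `h` is at most twice the Wick-rotated metric of `τ`. -/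
theorem IsSteep.inner_le_wick {h : RiemMetric n r M} (hs : S.IsSteep h τ) (hτ : S.IsTemporal τ)
    (x : M) (v : TangentSpace (𝓡∂ (n + 1)) x) :
    h.inner x v v ≤ 2 * (S.wick τ hτ).inner x v v := by
  have hN := hτ.2.2 x
  have hgrad : ∀ v, S.val x (S.grad τ x) v = diff τ x v := fun v => by rw [val_grad]
  have key := form_le_of_le_on_causal (S.symm x) (S.lorentz x) (h.symm x) hN
    (fun v => by
      rcases eq_or_ne v 0 with rfl | hv
      · simp
      · exact (h.pos x v hv).le)
    (fun v hvv => by rw [hgrad]; exact hs.inner_le_sq hvv) v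
  change _ ≤ 2 * S.wickForm τ x v v
  rw [S.wickForm_apply x hN.ne]
  simpa only [hgrad] using key

/-- If `dτ` is positive on future vectors, then `τ` is steep for half of the Wick-rotated metric:
on causal vectors the Wick-rotated form is at most `2 dτ ^ 2`. -/
theorem isSteep_half_wick (hτ : S.IsTemporal τ)
    (hpos : ∀ x, ∀ v ∈ S.future x, 0 < diff τ x v) : S.IsSteep (half (S.wick τ hτ)) τ := by
  refine ⟨hτ.2.1.of_le (by simp), fun x v hv => ?_⟩
  obtain ⟨T, hT, hfut⟩ := S.exists_timelike x
  have hvv : S.val x v v ≤ 0 := by rw [hfut] at hv; exact hv.2.1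
  have hN := hτ.2.2 x
  rw [Real.sqrt_le_left (hpos x v hv).le]
  change (1 / 2 : ℝ) * S.wickForm τ x v v ≤ _
  rw [S.wickForm_apply x hN.ne]
  rw [val_grad] at hN
  nlinarith

end Wick
end Spacetime

/-! ### The sign of the differential of a temporal function -/

/-- A line starting in a half-space stays in it for positive times or for negative times. -/
theorem exists_Icc_line_mem_halfSpace {n : ℕ} {q w : EuclideanSpace ℝ (Fin (n + 1))}
    (hq : q ∈ range (𝓡∂ (n + 1))) {ε : ℝ} (hε : 0 < ε) :
    ∃ a b : ℝ, a < b ∧ (0 : ℝ) ∈ Icc a b ∧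
      ∀ t ∈ Icc a b, q + t • w ∈ Metric.ball q ε ∩ range (𝓡∂ (n + 1)) := by
  rw [range_modelWithCornersEuclideanHalfSpace] at hq ⊢
  simp only [mem_ofPred_eq] at hq
  obtain ⟨δ, hδ, hδε⟩ : ∃ δ > 0, δ * ‖w‖ < ε := by
    refine ⟨ε / (2 * (‖w‖ + 1)), by positivity, ?_⟩
    rw [div_mul_eq_mul_div, div_lt_iff₀ (by positivity)]
    nlinarith [norm_nonneg w]
  have hball : ∀ t : ℝ, |t| ≤ δ → q + t • w ∈ Metric.ball q ε := by
    intro t ht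
    rw [mem_ball_iff_norm, add_sub_cancel_left, norm_smul, Real.norm_eq_abs]
    exact (mul_le_mul_of_nonneg_right ht (norm_nonneg w)).trans_lt hδε
  rcases le_total 0 (w 0) with h | h
  · refine ⟨0, δ, hδ, ⟨le_rfl, hδ.le⟩, fun t ht => ⟨hball t ?_, ?_⟩⟩
    · rw [abs_of_nonneg ht.1]; exact ht.2
    · have : 0 ≤ q 0 + t * w 0 := add_nonneg hq (mul_nonneg ht.1 h)
      simpa using this
  · refine ⟨-δ, 0, by linarith, ⟨by linarith, le_rfl⟩, fun t ht => ⟨hball t ?_, ?_⟩⟩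
    · rw [abs_of_nonpos ht.2]; linarith [ht.1]
    · have : 0 ≤ q 0 + t * w 0 := add_nonneg hq (mul_nonneg_of_nonpos_of_nonpos ht.2 h)
      simpa using this

namespace Spacetime

variable {n : ℕ} {r : ℕ∞} {M : Type*} [TopologicalSpace M]
  [ChartedSpace (EuclideanHalfSpace (n + 1)) M]

/-- A `C^1` curve is locally Lipschitz. -/
theorem isLocallyLipschitzCurve_of_contMDiffOn {γ : ℝ → M} {J : Set ℝ} (hJ : J.OrdConnected)
    (hγ : ContMDiffOn 𝓘(ℝ, ℝ) (𝓡∂ (n + 1)) 1 γ J) : IsLocallyLipschitzCurve (n := n) γ J := by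
  refine ⟨hγ.continuousOn, fun t ht => ?_⟩
  have h := (contMDiffWithinAt_iff_target.1 (hγ t ht)).2
  have h' : ContDiffWithinAt ℝ 1 (fun s => extChartAt (𝓡∂ (n + 1)) (γ t) (γ s)) J t :=
    contMDiffWithinAt_iff_contDiffWithinAt.1 h
  exact h'.exists_lipschitzOnWith hJ.convex

variable [IsManifold (𝓡∂ (n + 1)) 1 M]

theorem riemDist_comm (h : RiemMetric n r M) (x y : M) : riemDist h x y = riemDist h y x := by
  let : RiemannianBundle (fun x : M => TangentSpace (𝓡∂ (n + 1)) x) := ⟨h.toRiemannianMetric⟩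
  exact riemannianEDist_comm

variable {S : Spacetime n r M}

/-- The value at `x` of the time-orienting field `T`, extended with constant coefficients in the
chart at `x`, stays future near `x`. -/
theorem eventually_symmL_mem_future {x : M} {U : Set M} (hU : U ∈ 𝓝 x)
    {T : ∀ y : M, TangentSpace (𝓡∂ (n + 1)) y}
    (hT : ContinuousOn (fun y => (⟨y, T y⟩ : TangentBundle (𝓡∂ (n + 1)) M)) U)
    (hfut : ∀ y ∈ U, S.val y (T y) (T y) < 0 ∧
      S.future y = {v | v ≠ 0 ∧ S.val y v v ≤ 0 ∧ S.val y (T y) v < 0}) :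
    ∀ᶠ y in 𝓝 x, (trivializationAt (EuclideanSpace ℝ (Fin (n + 1)))
      (TangentSpace (𝓡∂ (n + 1))) x).symmL ℝ y (T x) ∈ S.future y := by
  set e := trivializationAt (EuclideanSpace ℝ (Fin (n + 1))) (TangentSpace (𝓡∂ (n + 1))) x with he
  let w : EuclideanSpace ℝ (Fin (n + 1)) := T x
  have hself : e.symmL ℝ x w = T x := symmL_trivializationAt_self x w
  change ∀ᶠ y in 𝓝 x, e.symmL ℝ y w ∈ S.future y
  clear_value w
  have hx : x ∈ e.baseSet := FiberBundle.mem_baseSet_trivializationAt' x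
  have hTx : ContinuousAt (fun y => (⟨y, T y⟩ : TangentBundle (𝓡∂ (n + 1)) M)) x :=
    hT.continuousAt hU
  have hW : ContinuousAt (fun y => (⟨y, e.symmL ℝ y w⟩ : TangentBundle (𝓡∂ (n + 1)) M)) x := by
    rw [FiberBundle.continuousAt_totalSpace]
    refine ⟨continuousAt_id, ?_⟩
    refine (continuousAt_const (y := w)).congr ?_
    filter_upwards [e.open_baseSet.mem_nhds hx] with y hy
    have := e.continuousLinearMapAt_symmL (R := ℝ) hy w
    rw [e.continuousLinearMapAt_apply_of_mem (R := ℝ) hy] at this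
    exact this.symm
  have hg : ContinuousAt (fun y => TotalSpace.mk' (EuclideanSpace ℝ (Fin (n + 1)) →L[ℝ]
      EuclideanSpace ℝ (Fin (n + 1)) →L[ℝ] ℝ) y (S.val y)) x := S.contMDiff.continuous.continuousAt
  have h1 : ContinuousAt (fun y => S.val y (e.symmL ℝ y w) (e.symmL ℝ y w)) x := by
    have := ContinuousAt.clm_bundle_apply₂ (F₁ := EuclideanSpace ℝ (Fin (n + 1)))
      (F₂ := EuclideanSpace ℝ (Fin (n + 1))) (E₃ := Bundle.Trivial M ℝ) hg hW hW
    exact ((FiberBundle.continuousAt_totalSpace ℝ _).1 this).2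
  have h2 : ContinuousAt (fun y => S.val y (T y) (e.symmL ℝ y w)) x := by
    have := ContinuousAt.clm_bundle_apply₂ (F₁ := EuclideanSpace ℝ (Fin (n + 1)))
      (F₂ := EuclideanSpace ℝ (Fin (n + 1))) (E₃ := Bundle.Trivial M ℝ) hg hTx hW
    exact ((FiberBundle.continuousAt_totalSpace ℝ _).1 this).2
  have hneg := (hfut x (mem_of_mem_nhds hU)).1
  have n1 : S.val x (e.symmL ℝ x w) (e.symmL ℝ x w) < 0 := by rwa [hself]
  have n2 : S.val x (T x) (e.symmL ℝ x w) < 0 := by rwa [hself]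
  filter_upwards [hU, h1.eventually_lt_const n1, h2.eventually_lt_const n2] with y hy hy1 hy2
  rw [(hfut y hy).2]
  refine ⟨?_, hy1.le, hy2⟩
  intro h0
  rw [h0, map_zero] at hy2
  exact lt_irrefl _ hy2

/-- If `w` is future causal near `x` in the chart at `x`, a generalized time function has nonnegative
derivative in the direction `w`. Indeed a segment through `x` of direction `w` in the chart, on the
side which stays in the manifold when `x` is a boundary point, is a future causal curve. -/
theorem diff_nonneg_of_isGeneralizedTimeFunction {τ : M → ℝ}
    (hτ : S.IsGeneralizedTimeFunction τ) {x : M}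
    (hd : MDifferentiableAt (𝓡∂ (n + 1)) 𝓘(ℝ, ℝ) τ x) {w : EuclideanSpace ℝ (Fin (n + 1))}
    (hw : ∀ᶠ y in 𝓝 x, (trivializationAt (EuclideanSpace ℝ (Fin (n + 1)))
      (TangentSpace (𝓡∂ (n + 1))) x).symmL ℝ y w ∈ S.future y) :
    0 ≤ diff τ x w := by
  set I := 𝓡∂ (n + 1) with hI
  set e := trivializationAt (EuclideanSpace ℝ (Fin (n + 1))) (TangentSpace I) x with he
  have h2 : ∀ᶠ q in 𝓝[range I] (extChartAt I x x),
      e.symmL ℝ ((extChartAt I x).symm q) w ∈ S.future ((extChartAt I x).symm q) := by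
    have hcont : ContinuousAt (extChartAt I x).symm (extChartAt I x x) :=
      continuousAt_extChartAt_symm _
    rw [ContinuousAt, extChartAt_to_inv] at hcont
    exact nhdsWithin_le_nhds (hcont.eventually hw)
  obtain ⟨ε, hε, hball⟩ := Metric.mem_nhdsWithin_iff.1
    (inter_mem (extChartAt_target_mem_nhdsWithin x) h2)
  obtain ⟨a, b, hab, h0, hline⟩ := exists_Icc_line_mem_halfSpace (w := w)
    (extChartAt_target_subset_range x (mem_extChartAt_target (I := I) x)) hε
  have hJ : ∀ t ∈ Icc a b, extChartAt I x x + t • w ∈ (extChartAt I x).target := fun t ht =>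
    (hball (hline t ht)).1
  set γ := chartLine I x (extChartAt I x x) w with hγ
  have hγs : ContMDiffOn 𝓘(ℝ, ℝ) I 1 γ (Icc a b) := contMDiffOn_chartLine hJ
  have hγ0 : γ 0 = x := by rw [hγ, chartLine, zero_smul, add_zero, extChartAt_to_inv]
  have hu : UniqueDiffOn ℝ (Icc a b) := uniqueDiffOn_Icc hab
  have hcausal : S.IsFutureCausalCurve γ (Icc a b) := by
    refine ⟨ordConnected_Icc, ⟨a, left_mem_Icc.2 hab.le, b, right_mem_Icc.2 hab.le, hab.ne⟩,
      isLocallyLipschitzCurve_of_contMDiffOn ordConnected_Icc hγs, ?_⟩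
    rw [← restrict_Ioo_eq_restrict_Icc, ae_restrict_iff' measurableSet_Ioo]
    refine Eventually.of_forall fun t ht => ?_
    have htI := Ioo_subset_Icc_self ht
    have hnhds := Icc_mem_nhds ht.1 ht.2
    refine ⟨(hγs.mdifferentiableOn one_ne_zero t htI).mdifferentiableAt hnhds, ?_⟩
    rw [← mfderivWithin_of_mem_nhds hnhds, hγ, mfderivWithin_chartLine hJ htI (hu t htI)]
    exact (hball (hline t htI)).2
  have hmono := (hτ γ _ hcausal).monotoneOn
  have h1 : mfderivWithin 𝓘(ℝ, ℝ) 𝓘(ℝ, ℝ) (τ ∘ γ) (Icc a b) 0 (1 : ℝ) =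
      diff τ (γ 0) (e.symmL ℝ (γ 0) w) := by
    rw [mfderiv_comp_mfderivWithin (I' := I) 0 (by rw [hγ0]; exact hd)
      (hγs.mdifferentiableOn one_ne_zero 0 h0)
      (by rw [uniqueMDiffWithinAt_iff_uniqueDiffWithinAt]; exact hu 0 h0)]
    exact congrArg (diff τ (γ 0)) (mfderivWithin_chartLine hJ h0 (hu 0 h0))
  rw [hγ0, symmL_trivializationAt_self] at h1
  rw [← h1, mfderivWithin_eq_fderivWithin]
  exact hmono.derivWithin_nonneg

/-- The differential of a temporal function is positive on future causal vectors. -/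
theorem IsTemporal.diff_pos {τ : M → ℝ} (hτ : S.IsTemporal τ) {x : M}
    {v : TangentSpace (𝓡∂ (n + 1)) x} (hv : v ∈ S.future x) : 0 < diff τ x v := by
  obtain ⟨U, hU, T, hTc, hT⟩ := S.time_oriented x
  obtain ⟨hTx, hfut⟩ := hT x (mem_of_mem_nhds hU)
  rw [hfut] at hv
  have hT0 : T x ≠ 0 := fun h => by simp [h] at hTx
  have hN := hτ.2.2 x
  have h0 : 0 ≤ diff τ x (T x) := diff_nonneg_of_isGeneralizedTimeFunction hτ.1
    (hτ.2.1.mdifferentiable (by simp) x) (eventually_symmL_mem_future hU hTc hT)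
  have h1 := (S.lorentz x).apply_ne_zero (S.symm x) hN hT0 hTx.le
  have h2 : 0 < S.val x (S.grad τ x) (T x) := by
    rw [val_grad] at h1 ⊢
    exact lt_of_le_of_ne h0 h1.symm
  have := (S.lorentz x).pos_of_causal (S.symm x) hN hTx h2 hv.2.1 hv.2.2
  rwa [val_grad] at this

/-! ### Causal curves and complete steep metrics -/

/-- Along a future causal curve the distance of a metric for which `τ` is steep is controlled by the
increment of `τ`. -/
theorem IsSteep.riemDist_le {h : RiemMetric n r M} {τ : M → ℝ} (hs : S.IsSteep h τ)
    (hτ : S.IsGeneralizedTimeFunction τ) {γ : ℝ → M} {J : Set ℝ} (hγ : S.IsFutureCausalCurve γ J)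
    {a b : ℝ} (ha : a ∈ J) (hb : b ∈ J) (hab : a ≤ b) :
    riemDist h (γ a) (γ b) ≤ ENNReal.ofReal (2 * (τ (γ b) - τ (γ a))) := by
  let : RiemannianBundle (fun x : M => TangentSpace (𝓡∂ (n + 1)) x) := ⟨h.toRiemannianMetric⟩
  have : IsContinuousRiemannianBundle (EuclideanSpace ℝ (Fin (n + 1)))
      (fun x : M => TangentSpace (𝓡∂ (n + 1)) x) :=
    ⟨h.inner, h.contMDiff.continuous, fun _ _ _ => rfl⟩
  have hmono := (hτ γ J hγ).monotoneOn
  obtain ⟨hJ, -, ⟨hc, hL⟩, hv⟩ := hγ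
  have hsub : Icc a b ⊆ J := hJ.out ha hb
  refine riemannianEDist_le_of_speed_le (I := 𝓡∂ (n + 1)) (f := τ ∘ γ) hab (hmono.mono hsub)
    (hc.mono hsub) ?_ ?_
  · intro t ht
    obtain ⟨K, W, hW, hK⟩ := hL t (hsub ht)
    exact ⟨K, W, nhdsWithin_mono _ hsub hW, hK⟩
  · filter_upwards [ae_restrict_of_ae_restrict_of_subset hsub hv] with t ⟨h1, h2⟩
    refine ⟨h1, ?_⟩
    have h3 : deriv (τ ∘ γ) t = diff τ (γ t) (mfderiv 𝓘(ℝ, ℝ) (𝓡∂ (n + 1)) γ t (1 : ℝ)) := by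
      have := mfderiv_comp t (hs.1.mdifferentiable one_ne_zero (γ t)) h1
      rw [mfderiv_eq_fderiv] at this
      exact congrArg (fun L : ℝ →L[ℝ] ℝ => L 1) this
    rw [h3, norm_eq_sqrt_real_inner]
    exact hs.2 _ _ h2

/-- A family of points whose distances are controlled by a convergent function converges, if the
metric is complete. -/
theorem IsComplete.exists_tendsto [RegularSpace M] {h : RiemMetric n r M} (hh : IsComplete h)
    {ι : Type*} {l : Filter ι} [l.NeBot] {u : ι → M} {f : ι → ℝ}
    (hd : ∀ i j, riemDist h (u i) (u j) ≤ ENNReal.ofReal (2 * |f i - f j|)) {L : ℝ}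
    (hf : Tendsto f l (𝓝 L)) : ∃ p, Tendsto u l (𝓝 p) := by
  let : RiemannianBundle (fun x : M => TangentSpace (𝓡∂ (n + 1)) x) := ⟨h.toRiemannianMetric⟩
  have : IsContinuousRiemannianBundle (EuclideanSpace ℝ (Fin (n + 1)))
      (fun x : M => TangentSpace (𝓡∂ (n + 1)) x) :=
    ⟨h.inner, h.contMDiff.continuous, fun _ _ _ => rfl⟩
  have hclose : ∀ δ > 0, ∀ᶠ i in l, |f i - L| < δ := fun δ hδ => by
    simpa [Real.dist_eq] using (Metric.tendsto_nhds.1 hf δ hδ)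
  have hlim := tendsto_one_div_add_atTop_nhds_zero_nat (𝕜 := ℝ)
  choose i hi using fun k : ℕ => (hclose (1 / ((k : ℝ) + 1)) (by positivity)).exists
  have hsmall : ∀ ε : ℝ≥0∞, 0 < ε → ∃ δ > 0, ∀ j k, |f j - L| < δ → |f k - L| < δ →
      riemDist h (u j) (u k) < ε := by
    intro ε hε
    obtain ⟨δ, hδ, hδε⟩ : ∃ δ : ℝ, 0 < δ ∧ ENNReal.ofReal δ < ε := by
      obtain ⟨c, hc0, hc⟩ := ENNReal.lt_iff_exists_nnreal_btwn.1 hε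
      exact ⟨c, by exact_mod_cast hc0, by simpa using hc⟩
    refine ⟨δ / 4, by positivity, fun j k hj hk => (hd j k).trans_lt (lt_of_le_of_lt ?_ hδε)⟩
    refine ENNReal.ofReal_le_ofReal ?_
    have := abs_sub_le (f j) L (f k)
    rw [abs_sub_comm L] at this
    linarith
  have hi' : ∀ δ > 0, ∀ᶠ k in atTop, |f (i k) - L| < δ := fun δ hδ =>
    (hlim.eventually_lt_const hδ).mono fun k hk => (hi k).trans hk
  obtain ⟨p, hp⟩ := hh (u ∘ i) fun ε hε => by
    obtain ⟨δ, hδ, hδε⟩ := hsmall ε hε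
    obtain ⟨N, hN⟩ := eventually_atTop.1 (hi' δ hδ)
    exact ⟨N, fun j hj k hk => hδε _ _ (hN j hj) (hN k hk)⟩
  -- the whole family is close to the points `u (i k)`, hence to their limit `p`
  refine ⟨p, fun s hs => ?_⟩
  obtain ⟨c, hc, hcs⟩ := setOfPred_riemannianEDist_lt_subset_nhds' (𝓡∂ (n + 1)) hs
  have hc2 : 0 < c / 2 := ENNReal.half_pos hc.ne'
  obtain ⟨δ, hδ, hδε⟩ := hsmall _ hc2
  obtain ⟨k, hk1, hk2⟩ := ((hp.eventually
    (eventually_riemannianEDist_lt (𝓡∂ (n + 1)) p hc2)).and (hi' δ hδ)).exists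
  rw [Filter.mem_map]
  filter_upwards [hclose δ hδ] with j hj
  refine hcs ?_
  calc riemannianEDist (𝓡∂ (n + 1)) p (u j)
      ≤ riemannianEDist (𝓡∂ (n + 1)) p (u (i k)) + riemannianEDist (𝓡∂ (n + 1)) (u (i k)) (u j) :=
        riemannianEDist_triangle
    _ < c / 2 + c / 2 := ENNReal.add_lt_add hk1 (hδε _ _ hk2 hj)
    _ = c := ENNReal.add_halves c

/-- The levels of a generalized time function which is steep for a complete metric are Cauchy
hypersurfaces: if `τ` is bounded in one direction along a future causal curve, then the curve has an
endpoint in this direction. -/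
theorem IsSteep.isCauchyHypersurface [RegularSpace M] {h : RiemMetric n r M} {τ : M → ℝ}
    (hs : S.IsSteep h τ) (hh : IsComplete h) (hτ : S.IsGeneralizedTimeFunction τ) (c : ℝ) :
    S.IsCauchyHypersurface (τ ⁻¹' {c}) := by
  rintro γ J ⟨hγ, -⟩ ⟨htop, hbot⟩
  have hmono := hτ γ J hγ
  have hcont : ContinuousOn (τ ∘ γ) J := hs.1.continuous.comp_continuousOn hγ.2.2.1.1
  have hd : ∀ s t : J, riemDist h (γ s) (γ t) ≤
      ENNReal.ofReal (2 * |τ (γ s) - τ (γ t)|) := by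
    have key : ∀ s t : J, s ≤ t → riemDist h (γ s) (γ t) ≤
        ENNReal.ofReal (2 * |τ (γ s) - τ (γ t)|) := fun s t hst => by
      rw [abs_sub_comm]
      exact (hs.riemDist_le hτ hγ s.2 t.2 hst).trans
        (ENNReal.ofReal_le_ofReal (by gcongr; exact le_abs_self _))
    intro s t
    rcases le_total s t with hst | hst
    · exact key s t hst
    · rw [abs_sub_comm, riemDist_comm]
      exact key t s hst
  have : Nonempty J := hγ.2.1.nonempty.to_subtype
  have hmono' : Monotone fun t : J => τ (γ t) := fun s t hst => hmono.monotoneOn s.2 t.2 hst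
  obtain ⟨t, ht, htc⟩ : ∃ t ∈ J, τ (γ t) = c := by
    by_contra! hne
    have hside : (∀ t ∈ J, τ (γ t) ≤ c) ∨ ∀ t ∈ J, c ≤ τ (γ t) := by
      by_contra! hcon
      obtain ⟨⟨s, hsJ, hsc⟩, t, htJ, htc⟩ := hcon
      obtain ⟨z, hz, hzc⟩ := hγ.1.isPreconnected.intermediate_value htJ hsJ hcont
        ⟨htc.le, hsc.le⟩
      exact hne z hz hzc
    rcases hside with hle | hle
    · refine htop (hh.exists_tendsto hd (tendsto_atTop_ciSup hmono' ⟨c, ?_⟩))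
      rintro _ ⟨t, rfl⟩
      exact hle t t.2
    · refine hbot (hh.exists_tendsto hd (tendsto_atBot_ciInf hmono' ⟨c, ?_⟩))
      rintro _ ⟨t, rfl⟩
      exact hle t t.2
  refine ⟨t, ⟨ht, htc⟩, ?_⟩
  rintro s ⟨hsJ, hsc⟩
  exact hmono.injOn hsJ ht (hsc.trans htc.symm)

end Spacetime

end Wick

theorem mainTheorem5 (n : ℕ) (r : ℕ∞) {M : Type*} [TopologicalSpace M] [T2Space M]
    [SecondCountableTopology M] [ChartedSpace (EuclideanHalfSpace (n + 1)) M]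
    [IsManifold (𝓡∂ (n + 1)) 1 M] [IsManifold (𝓡∂ (n + 1)) ((r : ℕ∞ω) + 1) M]
    (S : Wick.Spacetime n r M) (hS : S.IsStablyCausal)
    (τ : M → ℝ) (hτ : S.IsTemporal τ) (honto : Function.Surjective τ) :
    ((∃ h : Wick.Spacetime.RiemMetric n r M, Wick.Spacetime.IsComplete h ∧ S.IsSteep h τ) ↔
      Wick.Spacetime.IsComplete (S.wick τ hτ)) ∧
    (Wick.Spacetime.IsComplete (S.wick τ hτ) →
      S.IsSteep (Wick.Spacetime.half (S.wick τ hτ)) τ ∧ S.IsCauchyTemporal τ) := by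
  have hLC : LocallyCompactSpace M := Manifold.locallyCompact_of_finiteDimensional (𝓡∂ (n + 1))
  have hsq : (√2 : ℝ) ^ 2 = 2 := Real.sq_sqrt zero_le_two
  have hsteep : S.IsSteep (Wick.Spacetime.half (S.wick τ hτ)) τ :=
    Wick.Spacetime.isSteep_half_wick hτ fun x v hv => hτ.diff_pos hv
  have hhalf : Wick.Spacetime.IsComplete (S.wick τ hτ) →
      Wick.Spacetime.IsComplete (Wick.Spacetime.half (S.wick τ hτ)) := fun hc =>
    hc.of_inner_le (C := √2) (by positivity) fun x v => by
      change _ ≤ (√2) ^ 2 * ((1 / 2 : ℝ) * (S.wick τ hτ).inner x v v)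
      rw [hsq]
      linarith
  refine ⟨⟨?_, fun hc => ⟨_, hhalf hc, hsteep⟩⟩, fun hc =>
    ⟨hsteep, hτ, honto, hsteep.isCauchyHypersurface (hhalf hc) hτ.1⟩⟩
  rintro ⟨h, hc, hs⟩
  refine hc.of_inner_le (C := √2) (by positivity) fun x v => ?_
  rw [hsq]
  exact hs.inner_le_wick hτ x v
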